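/- Let $\Bbbk$ be a field and let $A$ be a basic finite-dimensional $\Bbbk$-algebra, regarded as a finite locally bounded $\Bbbk$-category: its objects form a fixed complete set $A_0$ of orthogonal primitive idempotents and $A(x,y)=yAx$. (Locally bounded: distinct objects are not isomorphic, the endomorphism algebras are local, the morphism spaces are finite-dimensional, and each object has nonzero morphisms to or from only finitely many objects.) Assume that $A$ has no nonzero oriented cycles, i.e. $A(x,x)=\Bbbk$ for all $x\in A_0$. All functors are $\Bbbk$-linear, and $D=\operatorname{Hom}_\Bbbk(-,\Bbbk)$. The repetitive category $\hat A$ has objects $x^{[i]}$ ($x\in A_0$, $i\in\mathbb Z$) and morphism spaces $\hat A(x^{[i]},y^{[i]})=\{f^{[i]} : f\in A(x,y)\}$, $\hat A(x^{[i]},y^{[i+1]})=\{\beta^{[i]} : \beta\in DA(y,x)\}$, and $\hat A(x^{[i]},y^{[j]})=0$ if $j\ne i,i+1$; composition is given by the composition of $A$ and the $A$-bimodule structure of $DA$, and is zero otherwise. Let $A^{[i]}$ be the full subcategory on the objects $x^{[i]}$ $(x\in A_0)$, $\mathrm{id}^{[i]}\colon A\to A^{[i]}$ the obvious isomorphism,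 and $\nu_A$ the Nakayama automorphism of $\hat A$, which raises all upper indices by $1$. An automorphism $\rho$ of $A$ induces the automorphism $\hat\rho$ of $\hat A$ with $x^{[i]}\mapsto(\rho x)^{[i]}$, $f^{[i]}\mapsto(\rho f)^{[i]}$, $\beta^{[i]}\mapsto(\beta\circ\rho^{-1})^{[i]}$. An automorphism $\phi$ of $\hat A$ has jump $n$ if $\phi(A^{[0]})=A^{[n]}$. For an automorphism $\phi$ of $\hat A$, the orbit category $\hat A/\langle\phi\rangle$ has as objects the $\langle\phi\rangle$-orbits of objects of $\hat A$; a morphism $X\to Y$ is a row- and column-finite family $(f_{v,u}\in\hat A(u,v))_{u\in X,\,v\in Y}$ with $f_{\phi v,\phi u}=\phi(f_{v,u})$, and composition is matrix multiplication. If $\langle\phi\rangle$ acts freely on the objects, then a choice of base points $x\in X$, $y\in Y$ of the orbits gives $(\hat A/\langle\phi\rangle)(X,Y)\cong\bigoplus_{a\in\mathbb Z}\hat A(\phi^a x,y)$, and this is a $\mathbb Z$-grading of $\hat A/\langle\phi\rangle$ whose part of degree $a$ is $\hat A(\phi^a x,y)$. (One may also take all objects $x$ of $\hat A$ as objects of the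 orbit category, $x$ standing for its orbit with base point $x$.) An isomorphism $H\colon\mathcal B\to\mathcal B'$ of $\mathbb Z$-graded categories is degree preserving with degree adjuster $r\colon\mathcal B_0\to\mathbb Z$ if $H(\mathcal B^{r_Y+a}(X,Y))=\mathcal B'^{\,a+r_X}(HX,HY)$ for all $X$, $Y$, $a$, and strictly degree preserving if this holds with $r=0$. Let $\phi$ be an automorphism of $\hat A$ with jump $n\neq 0$. Then $\phi_0:=(\mathrm{id}^{[0]})^{-1}\,\phi\,\nu_A^{-n}\,\mathrm{id}^{[0]}$ is a well-defined automorphism of $A$, and the generalized multifold extension $\hat A/\langle\phi\rangle$ and the twisted multifold extension $T^n_{\phi_0}(A):=\hat A/\langle\hat\phi_0\nu_A^n\rangle$ are isomorphic as $\mathbb Z$-graded categories. Precisely: both families above are indeed gradings; for any choices of base points of the orbits on the two sides there is an isomorphism that is degree preserving with some degree adjuster; every choice of base points of the $\langle\phi\rangle$-orbits is also a choice of base points of the $\langle\hat\phi_0\nu_A^n\rangle$-orbits, and for this common choice there is a strictly degree preserving isomorphism; and there is a strictly degree preserving isomorphism between the two orbit categories that have all objects of $\hat A$ as objects. -/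

import Mathlib

open CategoryTheory

universe w v u v' u' t

noncomputable section

/-! ### Linear categories -/

/-- A locally bounded `k`-category. A finite one is the same thing as a basic finite-dimensional
`k`-algebra with a fixed complete set of orthogonal primitive idempotents (the objects). -/
class LocallyBounded (k : Type w) [Field k] (C : Type u) [Category.{v} C] [Preadditive C]
    [Linear k C] : Prop where
  eq_of_iso : ∀ x y : C, Nonempty (x ≅ y) → x = y
  isLocalRing_end : ∀ x : C, IsLocalRing (End x)
  finite_hom : ∀ x y : C, Module.Finite k (x ⟶ y)
  finite_support : ∀ x : C, {y : C | Nontrivial (x ⟶ y) ∨ Nontrivial (y ⟶ x)}.Finite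

/-- `C(x, x) = k` for all objects `x`. -/
def NoNonzeroOrientedCycles (k : Type w) [Field k] (C : Type u) [Category.{v} C] [Preadditive C]
    [Linear k C] : Prop :=
  ∀ x : C, Function.Bijective (fun c : k => c • 𝟙 x)

/-- An isomorphism of `k`-linear categories: a `k`-linear functor that is bijective on objects
and on morphisms. -/
@[ext]
structure LinIso (k : Type w) [Field k] (C : Type u) [Category.{v} C] [Preadditive C] [Linear k C]
    (D : Type u') [Category.{v'} D] [Preadditive D] [Linear k D] where
  F : C ⥤ D
  additive : F.Additive
  linear : F.Linear k
  obj_bijective : Function.Bijective F.obj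
  map_bijective : ∀ x y : C, Function.Bijective (fun f : x ⟶ y => F.map f)

namespace LinIso

variable {k : Type w} [Field k] {C : Type u} [Category.{v} C] [Preadditive C] [Linear k C]

attribute [instance] LinIso.additive LinIso.linear

/-- The bijection `C(x, y) ≃ C(φ x, φ y)` given by an automorphism `φ`. -/
def homEquiv (φ : LinIso k C C) (x y : C) : (x ⟶ y) ≃ₗ[k] (φ.F.obj x ⟶ φ.F.obj y) :=
  LinearEquiv.ofBijective (φ.F.mapLinearMap k) (φ.map_bijective x y)

@[simp]
theorem homEquiv_apply (φ : LinIso k C C) {x y : C} (f : x ⟶ y) :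
    φ.homEquiv x y f = φ.F.map f := rfl

/-- The permutation of the set of objects given by an automorphism. -/
def perm (φ : LinIso k C C) : Equiv.Perm C := Equiv.ofBijective φ.F.obj φ.obj_bijective

/-- The composite automorphism `φ ∘ ψ` (first `ψ`, then `φ`). -/
def mul (φ ψ : LinIso k C C) : LinIso k C C where
  F := ψ.F ⋙ φ.F
  additive := inferInstance
  linear := inferInstance
  obj_bijective := φ.obj_bijective.comp ψ.obj_bijective
  map_bijective x y := (φ.map_bijective _ _).comp (ψ.map_bijective x y)

end LinIso

/-! ### The repetitive category -/

/-- Objects of the repetitive category: `⟨x, i⟩` is `x^{[i]}`. -/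
@[ext]
structure Repet (k : Type w) (A : Type u) where
  obj : A
  lvl : ℤ

namespace Repet

variable {k : Type w} [Field k] {A : Type u} [Category.{v} A] [Preadditive A] [Linear k A]

/-- The morphism space from `x^{[i]}` to `y^{[j]}`, as the space of pairs `(f, β)` with
`f ∈ A(x, y)` and `β ∈ D A(y, x)`, where `f = 0` unless `j = i` and `β = 0` unless `j = i + 1`.
So it is `A(x, y)` if `j = i`, `D A(y, x)` if `j = i + 1`, and zero otherwise. -/
def homSpace (X Y : Repet k A) :
    Submodule k ((X.obj ⟶ Y.obj) × Module.Dual k (Y.obj ⟶ X.obj)) where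
  carrier := {p | (Y.lvl ≠ X.lvl → p.1 = 0) ∧ (Y.lvl ≠ X.lvl + 1 → p.2 = 0)}
  add_mem' := by
    rintro p q ⟨hp, hp'⟩ ⟨hq, hq'⟩
    exact ⟨fun h => by simp [hp h, hq h], fun h => by simp [hp' h, hq' h]⟩
  zero_mem' := by simp
  smul_mem' := by
    rintro c p ⟨hp, hp'⟩
    exact ⟨fun h => by simp [hp h], fun h => by simp [hp' h]⟩

/-- The composite of `(f, β)` followed by `(g, γ)` is `(g f, g β + γ f)`, where
`(g β)(a) = β(a g)` and `(γ f)(a) = γ(f a)`. -/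
def homComp {X Y Z : Repet k A} (p : homSpace X Y) (q : homSpace Y Z) : homSpace X Z :=
  ⟨(p.1.1 ≫ q.1.1,
    p.1.2 ∘ₗ Linear.leftComp k X.obj q.1.1 + q.1.2 ∘ₗ Linear.rightComp k Z.obj p.1.1), by
    obtain ⟨⟨f, β⟩, hf, hβ⟩ := p
    obtain ⟨⟨g, γ⟩, hg, hγ⟩ := q
    simp only at hf hβ hg hγ
    constructor
    · intro h
      simp only
      by_cases h1 : Y.lvl = X.lvl
      · rw [hg (by rw [h1]; exact h)]; simp
      · rw [hf h1]; simp
    · intro h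
      simp only
      have e1 : β ∘ₗ Linear.leftComp k X.obj g = 0 := by
        by_cases h1 : Y.lvl = X.lvl + 1
        · rw [hg (by rw [h1]; exact h)]; ext a; simp
        · rw [hβ h1]; simp
      have e2 : γ ∘ₗ Linear.rightComp k Z.obj f = 0 := by
        by_cases h1 : Y.lvl = X.lvl
        · rw [hγ (by rw [h1]; exact h)]; simp
        · rw [hf h1]; ext a; simp
      rw [e1, e2, add_zero]⟩

instance : Category (Repet k A) where
  Hom X Y := homSpace X Y
  id X := ⟨(𝟙 X.obj, 0), by constructor <;> simp⟩
  comp p q := homComp p q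
  id_comp p := by
    apply Subtype.ext
    refine Prod.ext ?_ ?_
    · simp [homComp]
    · ext a; simp [homComp]
  comp_id p := by
    apply Subtype.ext
    refine Prod.ext ?_ ?_
    · simp [homComp]
    · ext a; simp [homComp]
  assoc p q r := by
    apply Subtype.ext
    refine Prod.ext ?_ ?_
    · simp [homComp]
    · ext a; simp [homComp, add_assoc]

theorem hom_ext {X Y : Repet k A} {p q : X ⟶ Y} (h1 : p.1.1 = q.1.1) (h2 : p.1.2 = q.1.2) :
    p = q := Subtype.ext (Prod.ext h1 h2)

theorem comp_fst {X Y Z : Repet k A} (p : X ⟶ Y) (q : Y ⟶ Z) :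
    (p ≫ q).1.1 = p.1.1 ≫ q.1.1 := rfl

theorem comp_snd {X Y Z : Repet k A} (p : X ⟶ Y) (q : Y ⟶ Z) (a : Z.obj ⟶ X.obj) :
    (p ≫ q).1.2 a = p.1.2 (q.1.1 ≫ a) + q.1.2 (a ≫ p.1.1) := rfl

theorem id_fst (X : Repet k A) : (𝟙 X : X ⟶ X).1.1 = 𝟙 X.obj := rfl

theorem id_snd (X : Repet k A) : (𝟙 X : X ⟶ X).1.2 = 0 := rfl

instance : Preadditive (Repet k A) where
  homGroup X Y := inferInstanceAs (AddCommGroup (homSpace X Y))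
  add_comp X Y Z p p' q := by
    refine hom_ext ?_ ?_
    · exact Preadditive.add_comp _ _ _ p.1.1 p'.1.1 q.1.1
    · ext a
      change (p.1.2 + p'.1.2) (q.1.1 ≫ a) + q.1.2 (a ≫ (p.1.1 + p'.1.1))
        = (p.1.2 (q.1.1 ≫ a) + q.1.2 (a ≫ p.1.1)) + (p'.1.2 (q.1.1 ≫ a) + q.1.2 (a ≫ p'.1.1))
      simp only [LinearMap.add_apply, Preadditive.comp_add, map_add]
      abel
  comp_add X Y Z p q q' := by
    refine hom_ext ?_ ?_
    · exact Preadditive.comp_add _ _ _ p.1.1 q.1.1 q'.1.1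
    · ext a
      change p.1.2 ((q.1.1 + q'.1.1) ≫ a) + (q.1.2 + q'.1.2) (a ≫ p.1.1)
        = (p.1.2 (q.1.1 ≫ a) + q.1.2 (a ≫ p.1.1)) + (p.1.2 (q'.1.1 ≫ a) + q'.1.2 (a ≫ p.1.1))
      simp only [LinearMap.add_apply, Preadditive.add_comp, map_add]
      abel

instance : Linear k (Repet k A) where
  homModule X Y := inferInstanceAs (Module k (homSpace X Y))
  smul_comp X Y Z c p q := by
    refine hom_ext ?_ ?_
    · exact Linear.smul_comp _ _ _ c p.1.1 q.1.1
    · ext a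
      change (c • p.1.2) (q.1.1 ≫ a) + q.1.2 (a ≫ (c • p.1.1))
        = c • (p.1.2 (q.1.1 ≫ a) + q.1.2 (a ≫ p.1.1))
      simp [mul_add]
  comp_smul X Y Z p c q := by
    refine hom_ext ?_ ?_
    · exact Linear.comp_smul _ _ _ p.1.1 c q.1.1
    · ext a
      change p.1.2 ((c • q.1.1) ≫ a) + (c • q.1.2) (a ≫ p.1.1)
        = c • (p.1.2 (q.1.1 ≫ a) + q.1.2 (a ≫ p.1.1))
      simp [mul_add]

theorem add_val {X Y : Repet k A} (p q : X ⟶ Y) : (p + q).1 = p.1 + q.1 := rfl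

theorem smul_val {X Y : Repet k A} (c : k) (p : X ⟶ Y) : (c • p).1 = c • p.1 := rfl

variable (k A) in
/-- The power `ν_A ^ n` of the Nakayama automorphism: `x^{[i]} ↦ x^{[i+n]}`,
`f^{[i]} ↦ f^{[i+n]}`, `β^{[i]} ↦ β^{[i+n]}`. -/
def nakayamaPow (n : ℤ) : LinIso k (Repet k A) (Repet k A) where
  F :=
    { obj := fun X => ⟨X.obj, X.lvl + n⟩
      map := fun {X Y} p =>
        ⟨p.1, fun h => p.2.1 (fun e => h (by simp [e])),
          fun h => p.2.2 (fun e => h (by simp only [e]; ring))⟩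
      map_id := fun _ => rfl
      map_comp := fun _ _ => rfl }
  additive := ⟨rfl⟩
  linear := ⟨fun _ _ => rfl⟩
  obj_bijective := by
    constructor
    · rintro ⟨x, i⟩ ⟨y, j⟩ h
      simpa using h
    · rintro ⟨x, i⟩
      exact ⟨⟨x, i - n⟩, by simp⟩
  map_bijective X Y := by
    constructor
    · intro p q h
      exact Subtype.ext (congrArg (fun r => r.1) h)
    · rintro ⟨p, h1, h2⟩
      refine ⟨⟨p, fun h => h1 (fun e => h ?_), fun h => h2 (fun e => h ?_)⟩, rfl⟩ <;>
        simp only at e <;> linarith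

variable (k A) in
/-- The embedding `id^{[i]}` of `A` onto the full subcategory `A^{[i]}`. -/
def incl (i : ℤ) : A ⥤ Repet k A where
  obj x := ⟨x, i⟩
  map f := ⟨(f, 0), fun h => absurd rfl h, fun _ => rfl⟩
  map_id _ := rfl
  map_comp f g := by
    refine hom_ext rfl (LinearMap.ext fun a => ?_)
    rw [comp_snd]
    simp

/-- The functor on the repetitive category induced by an automorphism `ρ` of `A`:
`x^{[i]} ↦ (ρ x)^{[i]}`, `f^{[i]} ↦ (ρ f)^{[i]}`, `β^{[i]} ↦ (β ∘ ρ⁻¹)^{[i]}`. -/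
def hatFunctor (ρ : LinIso k A A) : Repet k A ⥤ Repet k A where
  obj X := ⟨ρ.F.obj X.obj, X.lvl⟩
  map {X Y} p :=
    ⟨(ρ.F.map p.1.1, p.1.2 ∘ₗ (ρ.homEquiv Y.obj X.obj).symm.toLinearMap),
      fun h => by simp [p.2.1 h], fun h => by simp [p.2.2 h]⟩
  map_id X := hom_ext (ρ.F.map_id X.obj) (LinearMap.ext fun a => by simp [id_snd])
  map_comp {X Y Z} p q := by
    refine hom_ext (ρ.F.map_comp p.1.1 q.1.1) (LinearMap.ext fun a => ?_)
    obtain ⟨b, rfl⟩ := (ρ.homEquiv Z.obj X.obj).surjective a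
    have e1 : (ρ.homEquiv Y.obj X.obj).symm (ρ.F.map q.1.1 ≫ ρ.homEquiv Z.obj X.obj b)
        = q.1.1 ≫ b := by
      rw [LinearEquiv.symm_apply_eq]; simp
    have e2 : (ρ.homEquiv Z.obj Y.obj).symm (ρ.homEquiv Z.obj X.obj b ≫ ρ.F.map p.1.1)
        = b ≫ p.1.1 := by
      rw [LinearEquiv.symm_apply_eq]; simp
    rw [comp_snd]
    change (p ≫ q).1.2 ((ρ.homEquiv Z.obj X.obj).symm (ρ.homEquiv Z.obj X.obj b))
      = p.1.2 ((ρ.homEquiv Y.obj X.obj).symm (ρ.F.map q.1.1 ≫ ρ.homEquiv Z.obj X.obj b))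
        + q.1.2 ((ρ.homEquiv Z.obj Y.obj).symm (ρ.homEquiv Z.obj X.obj b ≫ ρ.F.map p.1.1))
    rw [e1, e2, LinearEquiv.symm_apply_apply, comp_snd]

theorem hatFunctor_map_fst (ρ : LinIso k A A) {X Y : Repet k A} (p : X ⟶ Y) :
    ((hatFunctor ρ).map p).1.1 = ρ.F.map p.1.1 := rfl

theorem hatFunctor_map_snd (ρ : LinIso k A A) {X Y : Repet k A} (p : X ⟶ Y)
    (a : Y.obj ⟶ X.obj) : ((hatFunctor ρ).map p).1.2 (ρ.F.map a) = p.1.2 a :=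
  congrArg p.1.2 ((ρ.homEquiv Y.obj X.obj).symm_apply_apply a)

/-- The automorphism of the repetitive category induced by an automorphism of `A`. -/
def hat (ρ : LinIso k A A) : LinIso k (Repet k A) (Repet k A) where
  F := hatFunctor ρ
  additive := ⟨fun {X Y p q} => hom_ext (ρ.F.map_add (f := p.1.1) (g := q.1.1)) rfl⟩
  linear := ⟨fun p c => hom_ext (ρ.F.map_smul c p.1.1) rfl⟩
  obj_bijective := by
    constructor
    · rintro ⟨x, i⟩ ⟨y, j⟩ h
      have h1 : ρ.F.obj x = ρ.F.obj y := congrArg Repet.obj h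
      have h2 : i = j := congrArg Repet.lvl h
      rw [ρ.obj_bijective.1 h1, h2]
    · rintro ⟨x, i⟩
      obtain ⟨y, rfl⟩ := ρ.obj_bijective.2 x
      exact ⟨⟨y, i⟩, rfl⟩
  map_bijective X Y := by
    constructor
    · intro p q h
      have h' : (hatFunctor ρ).map p = (hatFunctor ρ).map q := h
      refine hom_ext ((ρ.map_bijective _ _).1 ?_) (LinearMap.ext fun a => ?_)
      · change ((hatFunctor ρ).map p).1.1 = ((hatFunctor ρ).map q).1.1
        rw [h']
      · rw [← hatFunctor_map_snd ρ p, ← hatFunctor_map_snd ρ q, h']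
    · intro r
      obtain ⟨g, hg⟩ := (ρ.map_bijective X.obj Y.obj).2 r.1.1
      have hg' : ρ.F.map g = r.1.1 := hg
      let p : X ⟶ Y := ⟨(g, r.1.2 ∘ₗ (ρ.homEquiv Y.obj X.obj).toLinearMap),
        fun h => (ρ.map_bijective X.obj Y.obj).1 (by
          change ρ.F.map g = ρ.F.map 0
          rw [hg', Functor.map_zero]
          exact r.2.1 h),
        fun h => by
          have : r.1.2 = 0 := r.2.2 h
          simp only [this]
          exact LinearMap.zero_comp _⟩
      refine ⟨p, hom_ext hg' (LinearMap.ext fun a => ?_)⟩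
      exact congrArg r.1.2 ((ρ.homEquiv Y.obj X.obj).apply_symm_apply a)

/-- The automorphism `φ` of the repetitive category has jump `n`: `φ(A^{[0]}) = A^{[n]}`. -/
def HasJump (φ : LinIso k (Repet k A) (Repet k A)) (n : ℤ) : Prop :=
  φ.F.obj '' {X | X.lvl = 0} = {X | X.lvl = n}

/-- `φ₀ = (id^{[0]})⁻¹ ∘ φ ∘ ν_A^{-n} ∘ id^{[0]}`. -/
def IsLevelZero (φ : LinIso k (Repet k A) (Repet k A)) (n : ℤ) (φ₀ : LinIso k A A) : Prop :=
  incl k A 0 ⋙ (φ.mul (nakayamaPow k A (-n))).F = φ₀.F ⋙ incl k A 0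

/-- The automorphism `ρ̂ ν_A^n` of the repetitive category; its orbit category is the twisted
`n`-fold extension `T^n_ρ(A)`. -/
def twist (ρ : LinIso k A A) (n : ℤ) : LinIso k (Repet k A) (Repet k A) :=
  (hat ρ).mul (nakayamaPow k A n)

end Repet

/-! ### Orbit categories -/

section Orbit

variable {k : Type w} [Field k] {C : Type u} [Category.{v} C] [Preadditive C] [Linear k C]

/-- The orbits of the group generated by `φ` on the objects of `C`. -/
abbrev Orbits (φ : LinIso k C C) : Type u := Quotient (Equiv.Perm.SameCycle.setoid φ.perm)

/-- The orbit of an object. -/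
abbrev orbitOf (φ : LinIso k C C) (x : C) : Orbits φ :=
  Quotient.mk (Equiv.Perm.SameCycle.setoid φ.perm) x

/-- The space of morphisms in the orbit category from the orbit of `x` to the orbit of `y`:
the families `(f u v ∈ C(u, v))`, with `u` in the orbit of `x` and `v` in the orbit of `y`
(extended by zero to all `u`, `v`), that are row and column finite and invariant under the
group generated by `φ`, that is, `f (φ u) (φ v) = φ (f u v)`. Row and column finiteness is
automatic if `C` is locally bounded. -/
def orbitHom (φ : LinIso k C C) (x y : C) : Submodule k (∀ u v : C, u ⟶ v) where
  carrier := {f |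
    (∀ u v, ¬ (φ.perm.SameCycle x u ∧ φ.perm.SameCycle y v) → f u v = 0) ∧
    (∀ u, {v | f u v ≠ 0}.Finite) ∧ (∀ v, {u | f u v ≠ 0}.Finite) ∧
    ∀ u v, f (φ.F.obj u) (φ.F.obj v) = φ.F.map (f u v)}
  add_mem' := by
    rintro f g ⟨f1, f2, f3, f4⟩ ⟨g1, g2, g3, g4⟩
    refine ⟨fun u v h => by simp [f1 u v h, g1 u v h],
      fun u => ((f2 u).union (g2 u)).subset ?_, fun v => ((f3 v).union (g3 v)).subset ?_,
      fun u v => by simp [f4, g4]⟩ <;>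
    · intro z hz
      by_contra h
      simp only [Set.mem_union, Set.mem_ofPred_eq, not_or, not_not] at h
      exact hz (by simp [h.1, h.2])
  zero_mem' := by
    refine ⟨fun _ _ _ => rfl, fun u => ?_, fun v => ?_, fun u v => by simp⟩ <;> simp
  smul_mem' := by
    rintro c f ⟨f1, f2, f3, f4⟩
    refine ⟨fun u v h => by simp [f1 u v h], fun u => (f2 u).subset ?_,
      fun v => (f3 v).subset ?_, fun u v => by simp [f4]⟩ <;>
    · intro z hz h
      exact hz (by simp [h])

theorem orbitHom_finite_comp {φ : LinIso k C C} {x y z : C} (f : orbitHom φ x y)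
    (g : orbitHom φ y z) (u w : C) :
    (Function.support fun v => f.1 u v ≫ g.1 v w).Finite :=
  (f.2.2.1 u).subset fun v hv h => hv (by simp [h])

theorem LinIso.sameCycle_obj (φ : LinIso k C C) (x u : C) :
    φ.perm.SameCycle x (φ.F.obj u) ↔ φ.perm.SameCycle x u :=
  Equiv.Perm.sameCycle_apply_right

/-- Matrix composition of morphisms of the orbit category:
`(g f) u w = ∑ v, g v w ∘ f u v`, a finite sum. -/
def orbitComp {φ : LinIso k C C} {x y z : C} (f : orbitHom φ x y) (g : orbitHom φ y z) :
    orbitHom φ x z :=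
  ⟨fun u w => ∑ᶠ v, f.1 u v ≫ g.1 v w, by
    refine ⟨fun u w h => ?_, fun u => ?_, fun w => ?_, fun u w => ?_⟩
    · rw [not_and_or] at h
      rw [← finsum_zero (α := C)]
      refine finsum_congr fun v => ?_
      rcases h with h | h
      · rw [f.2.1 u v (fun h' => h h'.1)]; simp
      · rw [g.2.1 v w (fun h' => h h'.2)]; simp
    · refine ((f.2.2.1 u).biUnion fun v _ => g.2.2.1 v).subset fun w hw => ?_
      obtain ⟨v, hv⟩ : ∃ v, f.1 u v ≫ g.1 v w ≠ 0 := by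
        by_contra! h
        exact hw (by simp only [h, finsum_zero])
      refine Set.mem_biUnion (x := v) (fun h => hv (by simp [h])) (fun h => hv (by simp [h]))
    · refine ((g.2.2.2.1 w).biUnion fun v _ => f.2.2.2.1 v).subset fun u hu => ?_
      obtain ⟨v, hv⟩ : ∃ v, f.1 u v ≫ g.1 v w ≠ 0 := by
        by_contra! h
        exact hu (by simp only [h, finsum_zero])
      refine Set.mem_biUnion (x := v) (fun h => hv (by simp [h])) (fun h => hv (by simp [h]))
    · have := (φ.F.mapAddHom (X := u) (Y := w)).map_finsum (orbitHom_finite_comp f g u w)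
      simp only [Functor.coe_mapAddHom, Functor.map_comp] at this
      rw [this]
      refine (finsum_comp_equiv φ.perm).symm.trans (finsum_congr fun v => ?_)
      rw [← f.2.2.2.2, ← g.2.2.2.2]
      rfl⟩

open Classical in
/-- The identity of the orbit of `x` in the orbit category. -/
def orbitId (φ : LinIso k C C) (x : C) : orbitHom φ x x :=
  ⟨fun u v => if h : u = v ∧ φ.perm.SameCycle x u then eqToHom h.1 else 0, by
    refine ⟨fun u v h => dif_neg ?_, fun u => ?_, fun v => ?_, fun u v => ?_⟩
    · rintro ⟨rfl, h'⟩
      exact h ⟨h', h'⟩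
    · refine (Set.finite_singleton u).subset fun v hv => ?_
      by_contra h
      exact hv (dif_neg fun h' => h h'.1.symm)
    · refine (Set.finite_singleton v).subset fun u hu => ?_
      by_contra h
      exact hu (dif_neg fun h' => h h'.1)
    · beta_reduce
      by_cases h : u = v ∧ φ.perm.SameCycle x u
      · rw [dif_pos h, dif_pos ⟨congrArg φ.F.obj h.1, (φ.sameCycle_obj x u).2 h.2⟩,
          eqToHom_map]
      · rw [dif_neg h, dif_neg, Functor.map_zero]
        rintro ⟨h1, h2⟩
        exact h ⟨φ.obj_bijective.1 h1, (φ.sameCycle_obj x u).1 h2⟩⟩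

/-- The orbit category `C/⟨φ⟩`, with objects indexed through `p : ι → C`: the object `⟨i⟩` stands
for the orbit of `p i`, and `p i` is its base point, which is used for the grading below.
* If `ι = Orbits φ` and `p` picks a point of each orbit, then this is the classical
  orbit category, whose objects are the orbits.
* If `ι = C` and `p = id`, then this is the orbit category that has the same objects as `C`. -/
@[ext]
structure OrbitCat (φ : LinIso k C C) {ι : Type t} (p : ι → C) where
  idx : ι

namespace OrbitCat

variable {φ : LinIso k C C} {ι : Type t} {p : ι → C}

instance : Category (OrbitCat φ p) where
  Hom X Y := orbitHom φ (p X.idx) (p Y.idx)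
  id X := orbitId φ (p X.idx)
  comp f g := orbitComp f g
  id_comp {X Y} f := by
    apply Subtype.ext
    funext u w
    change ∑ᶠ v, (orbitId φ (p X.idx)).1 u v ≫ f.1 v w = f.1 u w
    rw [finsum_eq_single _ u]
    · by_cases h : φ.perm.SameCycle (p X.idx) u
      · simp [orbitId, h]
      · rw [f.2.1 u w (fun h' => h h'.1)]; simp
    · intro v hv
      simp only [orbitId]
      rw [dif_neg (fun h => hv h.1.symm)]
      simp
  comp_id {X Y} f := by
    apply Subtype.ext
    funext u w
    change ∑ᶠ v, f.1 u v ≫ (orbitId φ (p Y.idx)).1 v w = f.1 u w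
    rw [finsum_eq_single _ w]
    · by_cases h : φ.perm.SameCycle (p Y.idx) w
      · simp [orbitId, h]
      · rw [f.2.1 u w (fun h' => h h'.2)]; simp
    · intro v hv
      simp only [orbitId]
      rw [dif_neg (fun h => hv h.1)]
      simp
  assoc {X Y Z W} f g h := by
    apply Subtype.ext
    funext a d
    change ∑ᶠ c, (∑ᶠ b, f.1 a b ≫ g.1 b c) ≫ h.1 c d
      = ∑ᶠ b, f.1 a b ≫ (∑ᶠ c, g.1 b c ≫ h.1 c d)
    have e1 : ∀ c, (∑ᶠ b, f.1 a b ≫ g.1 b c) ≫ h.1 c d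
        = ∑ᶠ b, f.1 a b ≫ g.1 b c ≫ h.1 c d := fun c => by
      have := (Preadditive.rightComp a (h.1 c d)).map_finsum (orbitHom_finite_comp f g a c)
      simpa [Preadditive.rightComp] using this
    have e2 : ∀ b, f.1 a b ≫ (∑ᶠ c, g.1 b c ≫ h.1 c d)
        = ∑ᶠ c, f.1 a b ≫ g.1 b c ≫ h.1 c d := fun b => by
      have := (Preadditive.leftComp d (f.1 a b)).map_finsum (orbitHom_finite_comp g h b d)
      simpa [Preadditive.leftComp] using this
    simp only [e1, e2]
    set S : Finset C := (f.2.2.1 a).toFinset with hS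
    set T : Finset C := (h.2.2.2.1 d).toFinset with hT
    have s1 : ∀ c, ∑ᶠ b, f.1 a b ≫ g.1 b c ≫ h.1 c d
        = ∑ b ∈ S, f.1 a b ≫ g.1 b c ≫ h.1 c d := fun c => by
      refine finsum_eq_sum_of_support_subset _ fun b hb => ?_
      simp only [hS, Set.Finite.coe_toFinset]
      exact fun h0 => hb (by simp [h0])
    have s2 : ∀ b, ∑ᶠ c, f.1 a b ≫ g.1 b c ≫ h.1 c d
        = ∑ c ∈ T, f.1 a b ≫ g.1 b c ≫ h.1 c d := fun b => by
      refine finsum_eq_sum_of_support_subset _ fun c hc => ?_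
      simp only [hT, Set.Finite.coe_toFinset]
      exact fun h0 => hc (by simp [h0])
    rw [finsum_congr s1, finsum_congr s2, finsum_eq_sum_of_support_subset (s := T),
      finsum_eq_sum_of_support_subset (s := S), Finset.sum_comm]
    · intro b hb
      simp only [hS, Set.Finite.coe_toFinset]
      exact fun h0 => hb (by simp [h0])
    · intro c hc
      simp only [hT, Set.Finite.coe_toFinset]
      exact fun h0 => hc (by simp [h0])

theorem comp_apply {X Y Z : OrbitCat φ p} (f : X ⟶ Y) (g : Y ⟶ Z) (u w : C) :
    (f ≫ g).1 u w = ∑ᶠ v, f.1 u v ≫ g.1 v w := rfl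

instance : Preadditive (OrbitCat φ p) where
  homGroup X Y := inferInstanceAs (AddCommGroup (orbitHom φ (p X.idx) (p Y.idx)))
  add_comp X Y Z f f' g := by
    apply Subtype.ext
    funext u w
    change ∑ᶠ v, (f.1 u v + f'.1 u v) ≫ g.1 v w
      = ∑ᶠ v, f.1 u v ≫ g.1 v w + ∑ᶠ v, f'.1 u v ≫ g.1 v w
    rw [← finsum_add_distrib (orbitHom_finite_comp f g u w) (orbitHom_finite_comp f' g u w)]
    exact finsum_congr fun v => by simp
  comp_add X Y Z f g g' := by
    apply Subtype.ext
    funext u w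
    change ∑ᶠ v, f.1 u v ≫ (g.1 v w + g'.1 v w)
      = ∑ᶠ v, f.1 u v ≫ g.1 v w + ∑ᶠ v, f.1 u v ≫ g'.1 v w
    rw [← finsum_add_distrib (orbitHom_finite_comp f g u w) (orbitHom_finite_comp f g' u w)]
    exact finsum_congr fun v => by simp

instance : Linear k (OrbitCat φ p) where
  homModule X Y := inferInstanceAs (Module k (orbitHom φ (p X.idx) (p Y.idx)))
  smul_comp X Y Z c f g := by
    apply Subtype.ext
    funext u w
    change ∑ᶠ v, (c • f.1 u v) ≫ g.1 v w = c • ∑ᶠ v, f.1 u v ≫ g.1 v w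
    rw [smul_finsum]
    exact finsum_congr fun v => by simp
  comp_smul X Y Z f c g := by
    apply Subtype.ext
    funext u w
    change ∑ᶠ v, f.1 u v ≫ (c • g.1 v w) = c • ∑ᶠ v, f.1 u v ≫ g.1 v w
    rw [smul_finsum]
    exact finsum_congr fun v => by simp

end OrbitCat

end Orbit

/-! ### Graded categories -/

/-- A family of subspaces `B^a(X, Y)`, `a ∈ ℤ`, of all the morphism spaces `B(X, Y)`. -/
abbrev HomFamily (k : Type w) [Field k] (B : Type u) [Category.{v} B] [Preadditive B]
    [Linear k B] :=
  ∀ X Y : B, ℤ → Submodule k (X ⟶ Y)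

section Graded

variable {k : Type w} [Field k] {B : Type u} [Category.{v} B] [Preadditive B] [Linear k B]
  {B' : Type u'} [Category.{v'} B'] [Preadditive B'] [Linear k B']

/-- The family `𝓑` makes `B` a `ℤ`-graded category. -/
structure IsGrading (𝓑 : HomFamily k B) : Prop where
  isInternal : ∀ X Y : B, DirectSum.IsInternal (𝓑 X Y)
  comp_mem : ∀ (X Y Z : B) (a b : ℤ) (f : X ⟶ Y) (g : Y ⟶ Z),
    f ∈ 𝓑 X Y a → g ∈ 𝓑 Y Z b → f ≫ g ∈ 𝓑 X Z (b + a)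

/-- `F` is degree preserving, in both directions, with degree adjuster `r`. -/
def IsDegreePreserving (𝓑 : HomFamily k B) (𝓑' : HomFamily k B') (F : LinIso k B B')
    (r : B → ℤ) : Prop :=
  ∀ (X Y : B) (a : ℤ) (f : X ⟶ Y),
    f ∈ 𝓑 X Y (r Y + a) ↔ F.F.map f ∈ 𝓑' (F.F.obj X) (F.F.obj Y) (a + r X)

/-- `(B, 𝓑)` and `(B', 𝓑')` are `ℤ`-graded categories, and there is an isomorphism between them
that is degree preserving for some degree adjuster. -/
def GradedIsomorphic (𝓑 : HomFamily k B) (𝓑' : HomFamily k B') : Prop :=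
  IsGrading 𝓑 ∧ IsGrading 𝓑' ∧
    ∃ (F : LinIso k B B') (r : B → ℤ), IsDegreePreserving 𝓑 𝓑' F r

/-- `(B, 𝓑)` and `(B', 𝓑')` are `ℤ`-graded categories, and there is an isomorphism between them
that is strictly degree preserving. -/
def StrictlyGradedIsomorphic (𝓑 : HomFamily k B) (𝓑' : HomFamily k B') : Prop :=
  IsGrading 𝓑 ∧ IsGrading 𝓑' ∧
    ∃ F : LinIso k B B', IsDegreePreserving 𝓑 𝓑' F (fun _ => 0)

end Graded

/-- The grading of the orbit category. With `x`, `y` the base points of `X`, `Y`, a morphism `f`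
is determined by its components in `C(φ^j x, y)`, `j ∈ ℤ`; it has degree `a` if only the
component in `C(φ^a x, y)` is nonzero. So the part of degree `a` is `C(φ^a x, y)`. -/
def orbitGrading {k : Type w} [Field k] {C : Type u} [Category.{v} C] [Preadditive C]
    [Linear k C] (φ : LinIso k C C) {ι : Type t} (p : ι → C) : HomFamily k (OrbitCat φ p) :=
  fun X Y a =>
    { carrier := {f | ∀ j : ℤ, j ≠ a → f.1 ((φ.perm ^ j) (p X.idx)) (p Y.idx) = 0}
      add_mem' := fun {f g} hf hg j hj => by
        have := congrArg₂ (· + ·) (hf j hj) (hg j hj)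
        exact this.trans (add_zero 0)
      zero_mem' := fun _ _ => rfl
      smul_mem' := fun c f hf j hj => by
        have := congrArg (c • ·) (hf j hj)
        exact this.trans (smul_zero c) }

end

/-! Write `ψ` for `twist φ₀ n`. The point is that `φ` and `ψ` agree on objects and differ on
morphisms only by scalars, and that these scalars can be absorbed by rescaling the objects.

Objects. Since `A(x, x) = k`, there is a distinguished socle morphism from `x^{[i]}` to `x^{[i+1]}`,
and every nonzero morphism out of `x^{[i]}` extends to a nonzero multiple of it. This singles out
`x^{[i+1]}` among all objects in purely categorical terms (`Detects`, `detects_shift`,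
`eq_of_detects`), so every automorphism commutes with the Nakayama shift on objects. Hence `φ` moves
every level by `n`, `φ₀` exists, and `φ`, `ψ` agree on objects.

Morphisms. The family `θ = ψ⁻¹ φ` fixes all objects and is the identity on level `-n`. It multiplies
each socle morphism by a scalar. The pairing of `A(x, y)` with `D A(x, y)` appears as composition in
two orders, with values in the socles at `x` and at `y`; comparing the two carries `θ` from one
level to the next, and `exists_scalars` yields `θ f = (μ Y / μ X) f`.

Orbit categories. As `n ≠ 0`, the action on objects is free, so the cocycle `μ⁻¹` is a coboundary:
`m (φ u) = (μ u)⁻¹ m u`. Sending a family `f u v` to `(m v / m u) f u v` turns `φ`-invariant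
families into `ψ`-invariant ones. It does not change which entries vanish, so degrees change only
through the choice of base points. -/

/-! ### Cocycles of a permutation -/

section Cocycle

variable {C : Type u} {G : Type w} [Group G]

/-- The permutation `(u, g) ↦ (π u, h u * g)` of the total space of a cocycle `h`. -/
def Equiv.Perm.skewProduct (π : Equiv.Perm C) (h : C → G) : Equiv.Perm (C × G) where
  toFun p := (π p.1, h p.1 * p.2)
  invFun p := (π.symm p.1, (h (π.symm p.1))⁻¹ * p.2)
  left_inv p := by simp
  right_inv p := by simp

theorem Equiv.Perm.skewProduct_apply (π : Equiv.Perm C) (h : C → G) (p : C × G) :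
    π.skewProduct h p = (π p.1, h p.1 * p.2) := rfl

theorem Equiv.Perm.skewProduct_zpow_fst (π : Equiv.Perm C) (h : C → G) (j : ℤ) (p : C × G) :
    ((π.skewProduct h ^ j) p).1 = (π ^ j) p.1 := by
  induction j using Int.induction_on with
  | zero => rfl
  | succ i ih =>
    rw [add_comm, zpow_one_add, zpow_one_add, Equiv.Perm.mul_apply, Equiv.Perm.mul_apply,
      skewProduct_apply, ih]
  | pred i ih =>
    apply π.injective
    rw [← Equiv.Perm.mul_apply, ← zpow_one_add, add_sub_cancel, ← ih]
    conv_rhs => rw [← add_sub_cancel 1 (-(i : ℤ)), zpow_one_add, Equiv.Perm.mul_apply]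
    rfl

/-- A cocycle of a permutation with a transversal `r` and a time function `j` is a coboundary. -/
theorem Equiv.Perm.exists_coboundary (π : Equiv.Perm C) (h : C → G) (r : C → C) (j : C → ℤ)
    (hj : ∀ u, (π ^ j u) (r u) = u) (hr : ∀ u, r (π u) = r u) (hj' : ∀ u, j (π u) = 1 + j u) :
    ∃ m : C → G, (∀ u, m (π u) = h u * m u) ∧ ∀ u, j u = 0 → m u = 1 := by
  -- `m u` is the product of the values of `h` along the path from `r u` to `u`. Reading it off a
  -- power of the skew product covers negative `j u` without a separate definition.
  refine ⟨fun u => ((π.skewProduct h ^ j u) (r u, 1)).2, fun u => ?_, fun u hu => ?_⟩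
  · dsimp only
    rw [hr, hj', zpow_one_add, Equiv.Perm.mul_apply, skewProduct_apply, skewProduct_zpow_fst, hj]
  · simp [hu]

/-- A cocycle of a freely acting permutation is a coboundary. -/
theorem Equiv.Perm.exists_coboundary_of_free (π : Equiv.Perm C)
    (hπ : ∀ (u : C) (j : ℤ), (π ^ j) u = u → j = 0) (h : C → G) :
    ∃ m : C → G, ∀ u, m (π u) = h u * m u := by
  let r : C → C := fun u => (Quotient.mk (Equiv.Perm.SameCycle.setoid π) u).out
  have hr : ∀ u, π.SameCycle (r u) u := fun u =>
    Quotient.exact (s := Equiv.Perm.SameCycle.setoid π) (Quotient.out_eq _)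
  choose j hj using hr
  have hr' : ∀ u, r (π u) = r u := fun u => congrArg Quotient.out
    (Quotient.sound (s := Equiv.Perm.SameCycle.setoid π)
      (Equiv.Perm.sameCycle_apply_left.2 (Equiv.Perm.SameCycle.refl π u)))
  -- Freeness makes the exponent from `r u` to `u` unique, which forces `j (π u) = 1 + j u`.
  obtain ⟨m, hm, -⟩ := π.exists_coboundary h r j hj hr' fun u => by
    have h1 : (π ^ (1 + j u)) (r u) = π u := by
      rw [zpow_one_add, Equiv.Perm.mul_apply, hj]
    have h2 : (π ^ j (π u)) (r u) = (π ^ (1 + j u)) (r u) := by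
      rw [h1, ← hr', hj]
    have h3 : (π ^ (j (π u) - (1 + j u))) (r u) = r u := by
      rw [sub_eq_neg_add, zpow_add, Equiv.Perm.mul_apply, h2, ← Equiv.Perm.mul_apply, ← zpow_add]
      simp
    exact sub_eq_zero.1 (hπ _ _ h3)
  exact ⟨m, hm⟩

end Cocycle

/-! ### The grading of an orbit category -/

section Orbit

variable {k : Type w} [Field k] {C : Type u} [Category.{v} C] [Preadditive C] [Linear k C]

theorem LinIso.map_eq_zero_iff (φ : LinIso k C C) {x y : C} (f : x ⟶ y) :
    φ.F.map f = 0 ↔ f = 0 :=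
  (φ.homEquiv x y).map_eq_zero_iff

theorem LinIso.perm_apply (φ : LinIso k C C) (x : C) : φ.perm x = φ.F.obj x := rfl

theorem orbitHom_zpow_eq_zero_iff {φ : LinIso k C C} {x y : C} (f : orbitHom φ x y) (m : ℤ)
    (u v : C) : f.1 ((φ.perm ^ m) u) ((φ.perm ^ m) v) = 0 ↔ f.1 u v = 0 := by
  have key : ∀ u v, f.1 (φ.perm u) (φ.perm v) = 0 ↔ f.1 u v = 0 := fun u v => by
    rw [← φ.map_eq_zero_iff (f.1 u v), ← f.2.2.2.2]
    rfl
  induction m using Int.induction_on with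
  | zero => rfl
  | succ i ih =>
    rw [add_comm, zpow_one_add, Equiv.Perm.mul_apply, Equiv.Perm.mul_apply, key]
    exact ih
  | pred i ih =>
    rw [← key, ← Equiv.Perm.mul_apply, ← Equiv.Perm.mul_apply, ← zpow_one_add, add_sub_cancel]
    exact ih

/-- The component of a morphism of the orbit category in `C(φ^j x, y)`. -/
noncomputable def orbitHomComponent (φ : LinIso k C C) (x y : C) (j : ℤ) :
    orbitHom φ x y →ₗ[k] ((φ.perm ^ j) x ⟶ y) where
  toFun f := f.1 ((φ.perm ^ j) x) y
  map_add' _ _ := rfl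
  map_smul' _ _ := rfl

/-- By invariance the entry at `(φ^a x, φ^b y)` is a translate of the entry at `(φ^(a-b) x, y)`, so
the components determine the morphism. -/
theorem orbitHom_eq_zero {φ : LinIso k C C} {x y : C} (f : orbitHom φ x y)
    (h : ∀ j, orbitHomComponent φ x y j f = 0) : f = 0 := by
  apply Subtype.ext
  funext u v
  by_cases huv : φ.perm.SameCycle x u ∧ φ.perm.SameCycle y v
  · obtain ⟨⟨a, rfl⟩, ⟨b, rfl⟩⟩ := huv
    have : (φ.perm ^ a) x = (φ.perm ^ b) ((φ.perm ^ (a - b)) x) := by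
      rw [← Equiv.Perm.mul_apply, ← zpow_add, add_sub_cancel]
    rw [this]
    exact (orbitHom_zpow_eq_zero_iff f b _ _).2 (h (a - b))
  · exact f.2.1 u v huv

open Classical in
/-- The homogeneous part of degree `a` of a morphism of the orbit category. -/
noncomputable def orbitHomPart {φ : LinIso k C C} {x y : C} (f : orbitHom φ x y) (a : ℤ) :
    orbitHom φ x y :=
  ⟨fun u v => if ∃ m : ℤ, (φ.perm ^ m) ((φ.perm ^ a) x) = u ∧ (φ.perm ^ m) y = v
      then f.1 u v else 0, by
    refine ⟨fun u v h => ?_, fun u => (f.2.2.1 u).subset fun v hv h => hv ?_,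
      fun v => (f.2.2.2.1 v).subset fun u hu h => hu ?_, fun u v => ?_⟩
    · beta_reduce; rw [f.2.1 u v h, ite_self]
    · beta_reduce; rw [h, ite_self]
    · beta_reduce; rw [h, ite_self]
    · have : (∃ m : ℤ, (φ.perm ^ m) ((φ.perm ^ a) x) = φ.F.obj u ∧
          (φ.perm ^ m) y = φ.F.obj v) ↔
          ∃ m : ℤ, (φ.perm ^ m) ((φ.perm ^ a) x) = u ∧ (φ.perm ^ m) y = v := by
        -- Replacing `m` by `1 + m` shows that the set of retained entries is stable under `φ`.
        rw [← (Equiv.addLeft (1 : ℤ)).exists_congr_right]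
        simp only [Equiv.coe_addLeft, zpow_one_add, Equiv.Perm.mul_apply, ← LinIso.perm_apply,
          EmbeddingLike.apply_eq_iff_eq]
      beta_reduce
      by_cases h : ∃ m : ℤ, (φ.perm ^ m) ((φ.perm ^ a) x) = u ∧ (φ.perm ^ m) y = v
      · rw [if_pos h, if_pos (this.2 h), f.2.2.2.2]
      · rw [if_neg h, if_neg (fun h' => h (this.1 h')), Functor.map_zero]⟩

theorem orbitHomPart_component_self {φ : LinIso k C C} {x y : C} (f : orbitHom φ x y) (a : ℤ) :
    orbitHomComponent φ x y a (orbitHomPart f a) = orbitHomComponent φ x y a f :=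
  if_pos ⟨0, rfl, rfl⟩

theorem orbitHomPart_component_of_ne {φ : LinIso k C C}
    (hfree : ∀ (u : C) (j : ℤ), (φ.perm ^ j) u = u → j = 0) {x y : C} (f : orbitHom φ x y) {a j : ℤ}
    (hj : j ≠ a) :
    orbitHomComponent φ x y j (orbitHomPart f a) = 0 := by
  refine if_neg ?_
  rintro ⟨m, h1, h2⟩
  obtain rfl := hfree _ _ h2
  apply hj
  have : (φ.perm ^ (j - a)) x = x := by
    rw [sub_eq_neg_add, zpow_add, Equiv.Perm.mul_apply, ← h1, zpow_zero, Equiv.Perm.one_apply,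
      ← Equiv.Perm.mul_apply, ← zpow_add]
    simp
  exact sub_eq_zero.1 (hfree _ _ this)

/-- Freeness makes `j ↦ φ^j x` injective, so distinct degrees occupy distinct entries and
`orbitHomPart` splits a morphism into homogeneous parts. -/
theorem isGrading_orbitGrading {φ : LinIso k C C}
    (hfree : ∀ (u : C) (j : ℤ), (φ.perm ^ j) u = u → j = 0) {ι : Type t} (p : ι → C) :
    IsGrading (orbitGrading φ p) where
  isInternal X Y := by
    rw [DirectSum.isInternal_submodule_iff_iSupIndep_and_iSup_eq_top]
    constructor
    · intro a
      rw [Submodule.disjoint_def]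
      intro f hf hf'
      refine orbitHom_eq_zero f fun j => ?_
      by_cases hj : j = a
      · subst hj
        have : ⨆ i, ⨆ (_ : i ≠ j), orbitGrading φ p X Y i ≤
            LinearMap.ker (orbitHomComponent φ (p X.idx) (p Y.idx) j) :=
          iSup₂_le fun i hi g hg => hg j hi.symm
        exact this hf'
      · exact hf j hj
    · rw [eq_top_iff]
      rintro f -
      -- The components all lie in the column of the base point of `Y`, which is finite.
      have hfin : {j : ℤ | orbitHomComponent φ (p X.idx) (p Y.idx) j f ≠ 0}.Finite := by
        refine Set.Finite.of_finite_image ((f.2.2.2.1 (p Y.idx)).subset ?_)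
          (f := fun j => (φ.perm ^ j) (p X.idx)) ?_
        · rintro _ ⟨j, hj, rfl⟩
          exact hj
        · intro i _ j _ hij
          have : (φ.perm ^ (i - j)) (p X.idx) = p X.idx := by
            rw [sub_eq_neg_add, zpow_add, Equiv.Perm.mul_apply]
            refine (congrArg (φ.perm ^ (-j)) hij).trans ?_
            rw [← Equiv.Perm.mul_apply, ← zpow_add]
            simp
          exact sub_eq_zero.1 (hfree _ _ this)
      have hsum : f = ∑ a ∈ hfin.toFinset, (orbitHomPart f a : X ⟶ Y) := by
        refine sub_eq_zero.1 (orbitHom_eq_zero (f - ∑ a ∈ hfin.toFinset, orbitHomPart f a)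
          fun j => ?_)
        rw [map_sub, map_sum, sub_eq_zero]
        by_cases hj : j ∈ hfin.toFinset
        · rw [Finset.sum_eq_single_of_mem j hj fun a _ ha =>
            orbitHomPart_component_of_ne hfree f ha.symm, orbitHomPart_component_self]
        · rw [Finset.sum_eq_zero fun a ha =>
            orbitHomPart_component_of_ne hfree f (ne_of_mem_of_not_mem ha hj).symm]
          simpa using hj
      rw [hsum]
      exact Submodule.sum_mem _ fun a _ => Submodule.mem_iSup_of_mem a
        fun j hj => orbitHomPart_component_of_ne hfree f hj
  comp_mem X Y Z a b f g hf hg j hj := by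
    rw [OrbitCat.comp_apply]
    refine (finsum_congr fun v => ?_).trans finsum_zero
    by_cases hv : φ.perm.SameCycle (p Y.idx) v
    · obtain ⟨m, rfl⟩ := hv
      -- Only `v = φ^b y` can contribute from `g`; translating back by `φ^b`, the entry of `f` is
      -- its component of degree `j - b`, which vanishes unless `j = b + a`.
      by_cases hm : m = b
      · subst hm
        have e : (φ.perm ^ j) (p X.idx) = (φ.perm ^ m) ((φ.perm ^ (j - m)) (p X.idx)) := by
          rw [← Equiv.Perm.mul_apply, ← zpow_add, add_sub_cancel]
        have : f.1 ((φ.perm ^ j) (p X.idx)) ((φ.perm ^ m) (p Y.idx)) = 0 := by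
          rw [e, orbitHom_zpow_eq_zero_iff]
          exact hf _ fun h => hj (by omega)
        rw [this, Limits.zero_comp]
      · rw [hg m hm, Limits.comp_zero]
    · rw [g.2.1 v _ fun h => hv h.1, Limits.comp_zero]

end Orbit

/-! ### Rescaling isomorphisms of orbit categories -/

section Skew

variable {k : Type w} [Field k] {C : Type u} [Category.{v} C] [Preadditive C] [Linear k C]

theorem heq_inv_smul {X Y X' Y' : C} (hX : X = X') (hY : Y = Y') {a : X ⟶ Y} {b : X' ⟶ Y'}
    {c : kˣ} (h : HEq a (c • b)) : HEq b (c⁻¹ • a) := by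
  subst hX hY
  rw [eq_of_heq h, inv_smul_smul]

/-- The automorphism `ψ` agrees with `φ` on objects, and on morphisms up to scalars, in such a way
that rescaling the family `(f u v)` to `(m v / m u) f u v` turns `φ`-invariant families into
`ψ`-invariant ones. -/
structure LinIso.IsRescaling (φ ψ : LinIso k C C) (m : C → kˣ) : Prop where
  obj_eq : ∀ x, φ.F.obj x = ψ.F.obj x
  map_heq : ∀ {x y : C} (f : x ⟶ y), HEq (ψ.F.map f)
    (((m (φ.F.obj x))⁻¹ * m x * ((m y)⁻¹ * m (φ.F.obj y))) • φ.F.map f)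

namespace LinIso.IsRescaling

variable {φ ψ : LinIso k C C} {m : C → kˣ}

theorem perm_eq (h : φ.IsRescaling ψ m) : φ.perm = ψ.perm := Equiv.ext h.obj_eq

theorem symm (h : φ.IsRescaling ψ m) : ψ.IsRescaling φ m⁻¹ where
  obj_eq x := (h.obj_eq x).symm
  map_heq {x y} f := by
    convert heq_inv_smul (h.obj_eq x).symm (h.obj_eq y).symm (h.map_heq f) using 2
    rw [← h.obj_eq, ← h.obj_eq]
    simp only [Pi.inv_apply, mul_inv, inv_inv]

/-- Rescaling a morphism between orbits. -/
def homMap (h : φ.IsRescaling ψ m) {x y x' y' : C} (hx : φ.perm.SameCycle x x')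
    (hy : φ.perm.SameCycle y y') : orbitHom φ x y →ₗ[k] orbitHom ψ x' y' where
  toFun f := ⟨fun u v => ((m u)⁻¹ * m v) • f.1 u v, by
    refine ⟨fun u v h' => ?_, fun u => (f.2.2.1 u).subset fun v hv h => hv (by simp [h]),
      fun v => (f.2.2.2.1 v).subset fun u hu h => hu (by simp [h]), fun u v => ?_⟩
    · beta_reduce
      rw [f.2.1 u v fun h'' => h' ?_, smul_zero]
      rw [← h.perm_eq]
      exact ⟨hx.symm.trans h''.1, hy.symm.trans h''.2⟩
    · apply eq_of_heq
      have h1 : HEq (((m (ψ.F.obj u))⁻¹ * m (ψ.F.obj v)) • f.1 (ψ.F.obj u) (ψ.F.obj v))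
          (((m (φ.F.obj u))⁻¹ * m (φ.F.obj v)) • f.1 (φ.F.obj u) (φ.F.obj v)) := by
        rw [h.obj_eq u, h.obj_eq v]
      -- The factors `m u` and `m v` cancel against those in `map_heq`, leaving the factor at `(φ u,
      -- φ v)`.
      refine h1.trans (HEq.trans (heq_of_eq ?_) (h.map_heq (((m u)⁻¹ * m v) • f.1 u v)).symm)
      rw [f.2.2.2.2, Units.smul_def, Units.smul_def, Units.smul_def, Functor.map_smul, smul_smul,
        ← Units.val_mul]
      congr 1
      push_cast
      field_simp⟩
  map_add' f g := Subtype.ext (funext fun u => funext fun v => smul_add _ _ _)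
  map_smul' c f := Subtype.ext (funext fun u => funext fun v => smul_comm _ _ _)

theorem homMap_apply (h : φ.IsRescaling ψ m) {x y x' y' : C} (hx : φ.perm.SameCycle x x')
    (hy : φ.perm.SameCycle y y') (f : orbitHom φ x y) (u v : C) :
    (h.homMap hx hy f).1 u v = ((m u)⁻¹ * m v) • f.1 u v := rfl

theorem homMap_bijective (h : φ.IsRescaling ψ m) {x y x' y' : C} (hx : φ.perm.SameCycle x x')
    (hy : φ.perm.SameCycle y y') : Function.Bijective (h.homMap hx hy) := by
  have hx' : ψ.perm.SameCycle x' x := h.perm_eq ▸ hx.symm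
  have hy' : ψ.perm.SameCycle y' y := h.perm_eq ▸ hy.symm
  refine Function.bijective_iff_has_inverse.2 ⟨h.symm.homMap hx' hy', fun f => ?_, fun f => ?_⟩ <;>
  · refine Subtype.ext (funext fun u => funext fun v => ?_)
    simp only [homMap_apply, Pi.inv_apply, smul_smul]
    convert one_smul kˣ _ using 2
    apply Units.ext
    push_cast
    field_simp

variable {ι : Type t} {ι' : Type u'} {p : ι → C} {q : ι' → C}

/-- The isomorphism of orbit categories given by rescaling. -/
def orbitIso (h : φ.IsRescaling ψ m) (e : ι ≃ ι')
    (he : ∀ i, φ.perm.SameCycle (p i) (q (e i))) : LinIso k (OrbitCat φ p) (OrbitCat ψ q) where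
  F :=
    { obj := fun X => ⟨e X.idx⟩
      map := fun {X Y} f => h.homMap (he X.idx) (he Y.idx) f
      map_id := fun X => by
        refine Subtype.ext (funext fun u => funext fun v => ?_)
        rw [homMap_apply]
        change _ • (orbitId φ (p X.idx)).1 u v = (orbitId ψ (q (e X.idx))).1 u v
        simp only [orbitId]
        by_cases huv : u = v ∧ φ.perm.SameCycle (p X.idx) u
        · rw [dif_pos huv, dif_pos ⟨huv.1, h.perm_eq ▸ (he X.idx).symm.trans huv.2⟩,
            congrArg m huv.1, inv_mul_cancel, one_smul]
        · rw [dif_neg huv, smul_zero, dif_neg]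
          rintro ⟨h1, h2⟩
          exact huv ⟨h1, (he X.idx).trans (h.perm_eq ▸ h2)⟩
      map_comp := fun {X Y Z} f g => by
        refine Subtype.ext (funext fun u => funext fun w => ?_)
        rw [homMap_apply, OrbitCat.comp_apply, OrbitCat.comp_apply, Units.smul_def, smul_finsum]
        refine finsum_congr fun v => ?_
        rw [homMap_apply, homMap_apply, Units.smul_def, Units.smul_def, Linear.smul_comp,
          Linear.comp_smul, smul_smul, ← Units.val_mul]
        congr 1
        push_cast
        field_simp }
  additive := ⟨fun {_ _ f g} => map_add (h.homMap _ _) f g⟩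
  linear := ⟨fun f c => map_smul (h.homMap _ _) c f⟩
  obj_bijective := ⟨fun X Y hXY => OrbitCat.ext (e.injective (congrArg OrbitCat.idx hXY)),
    fun Y => ⟨⟨e.symm Y.idx⟩, OrbitCat.ext (e.apply_symm_apply _)⟩⟩
  map_bijective X Y := h.homMap_bijective (he X.idx) (he Y.idx)

/-- Rescaling by units keeps zero entries zero. Moving the base points by `φ^d` makes component `j`
of the image correspond to component `j + d X - d Y` of `f`, hence the adjuster `-d`. -/
theorem isDegreePreserving_orbitIso (h : φ.IsRescaling ψ m) (e : ι ≃ ι') (d : ι → ℤ)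
    (hd : ∀ i, (φ.perm ^ d i) (p i) = q (e i)) :
    IsDegreePreserving (orbitGrading φ p) (orbitGrading ψ q)
      (h.orbitIso e fun i => ⟨d i, hd i⟩) fun X => -d X.idx := by
  intro X Y a f
  have hs : ∀ i, φ.perm.SameCycle (p i) (q (e i)) := fun i => ⟨d i, hd i⟩
  have key : ∀ j : ℤ, ((h.homMap (hs X.idx) (hs Y.idx) f).1
      ((ψ.perm ^ j) (q (e X.idx))) (q (e Y.idx)) = 0 ↔
        f.1 ((φ.perm ^ (-d Y.idx + (j + d X.idx))) (p X.idx)) (p Y.idx) = 0) := fun j => by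
    rw [homMap_apply, smul_eq_zero_iff_eq, ← h.perm_eq, ← hd, ← hd, ← Equiv.Perm.mul_apply,
      ← zpow_add, ← orbitHom_zpow_eq_zero_iff f (d Y.idx) _ (p Y.idx), ← Equiv.Perm.mul_apply,
      ← zpow_add, add_neg_cancel_left]
  constructor
  · intro hf j hj
    refine (key j).2 (hf _ fun h' => hj ?_)
    dsimp only at h' ⊢
    omega
  · intro hf j hj
    have := (key (d Y.idx + j - d X.idx)).1 (hf _ fun h' => hj (by dsimp only at h' ⊢; omega))
    convert this using 3 <;> congr 1 <;> ring_nf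

end LinIso.IsRescaling

end Skew

/-! ### Homogeneous morphisms of the repetitive category -/

namespace Repet

variable {k : Type w} [Field k] {A : Type u} [Category.{v} A] [Preadditive A] [Linear k A]

theorem heq_of_val_eq {x y : A} {i i' j j' : ℤ} (hi : i = i') (hj : j = j')
    {p : (⟨x, i⟩ : Repet k A) ⟶ ⟨y, j⟩} {p' : (⟨x, i'⟩ : Repet k A) ⟶ ⟨y, j'⟩}
    (h : p.1 = p'.1) : HEq p p' := by
  subst hi hj
  exact heq_of_eq (Subtype.ext h)

/-- The morphism `f^{[i]} : x^{[i]} ⟶ y^{[i]}`. -/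
def levelHom {x y : A} (i : ℤ) (f : x ⟶ y) : (⟨x, i⟩ : Repet k A) ⟶ ⟨y, i⟩ :=
  (incl k A i).map f

/-- The morphism `β^{[i]} : x^{[i]} ⟶ y^{[i+1]}`. -/
def dualHom {x y : A} (i : ℤ) (β : Module.Dual k (y ⟶ x)) :
    (⟨x, i⟩ : Repet k A) ⟶ ⟨y, i + 1⟩ :=
  ⟨(0, β), fun _ => rfl, fun h => absurd rfl h⟩

theorem levelHom_comp_dualHom {x y z : A} (i : ℤ) (f : x ⟶ y) (β : Module.Dual k (z ⟶ y)) :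
    levelHom i f ≫ dualHom i β = dualHom i (β ∘ₗ Linear.rightComp k z f) := by
  refine hom_ext Limits.comp_zero (LinearMap.ext fun a => ?_)
  rw [comp_snd]
  exact zero_add _

theorem dualHom_comp_levelHom {x y z : A} (i : ℤ) (β : Module.Dual k (y ⟶ x)) (f : y ⟶ z) :
    dualHom i β ≫ levelHom (i + 1) f = dualHom i (β ∘ₗ Linear.leftComp k x f) := by
  refine hom_ext Limits.zero_comp (LinearMap.ext fun a => ?_)
  rw [comp_snd]
  exact add_zero _

theorem levelHom_injective {x y : A} (i : ℤ) {f g : x ⟶ y}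
    (h : levelHom (k := k) i f = levelHom i g) : f = g :=
  congrArg (fun p => p.1.1) h

theorem exists_levelHom_eq {x y : A} {i : ℤ} (p : (⟨x, i⟩ : Repet k A) ⟶ ⟨y, i⟩) :
    ∃ f, p = levelHom i f :=
  ⟨p.1.1, hom_ext rfl (p.2.2 (by simp))⟩

theorem exists_dualHom_eq {x y : A} {i : ℤ} (p : (⟨x, i⟩ : Repet k A) ⟶ ⟨y, i + 1⟩) :
    ∃ β, p = dualHom i β :=
  ⟨p.1.2, hom_ext (p.2.1 (by simp)) rfl⟩

theorem hom_eq_zero {X Y : Repet k A} (h : Y.lvl ≠ X.lvl) (h' : Y.lvl ≠ X.lvl + 1) (p : X ⟶ Y) :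
    p = 0 :=
  hom_ext (p.2.1 h) (p.2.2 h')

theorem smul_levelHom {x y : A} (i : ℤ) (c : k) (f : x ⟶ y) :
    c • levelHom (k := k) i f = levelHom i (c • f) :=
  hom_ext rfl (smul_zero c)

theorem smul_dualHom {x y : A} (i : ℤ) (c : k) (β : Module.Dual k (y ⟶ x)) :
    c • dualHom i β = dualHom i (c • β) :=
  hom_ext (smul_zero c) rfl

/-! ### The socle of the projective modules of the repetitive category -/

section Acyclic

variable (hA : NoNonzeroOrientedCycles k A)

/-- The identification of `A(x, x)` with `k`. -/
noncomputable def endEquiv (hA : NoNonzeroOrientedCycles k A) (x : A) : k ≃ₗ[k] (x ⟶ x) :=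
  LinearEquiv.ofBijective (LinearMap.toSpanSingleton k (x ⟶ x) (𝟙 x)) (hA x)

/-- The dual of the identity of `x`. -/
noncomputable def idDual (hA : NoNonzeroOrientedCycles k A) (x : A) : Module.Dual k (x ⟶ x) :=
  (endEquiv hA x).symm.toLinearMap

theorem idDual_smul_id (x : A) (a : x ⟶ x) : idDual hA x a • 𝟙 x = a :=
  (endEquiv hA x).apply_symm_apply a

theorem idDual_id (x : A) : idDual hA x (𝟙 x) = 1 := by
  refine (LinearEquiv.symm_apply_eq _).2 ?_
  exact (one_smul k (𝟙 x)).symm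

theorem dual_end_eq {x : A} (γ : Module.Dual k (x ⟶ x)) : γ = γ (𝟙 x) • idDual hA x := by
  ext a
  conv_lhs => rw [← idDual_smul_id hA x a, map_smul]
  simp [mul_comm]

/-- The morphism `x^{[i]} ⟶ x^{[i+1]}` given by the dual of the identity of `x`. -/
noncomputable def socleHom (hA : NoNonzeroOrientedCycles k A) (x : A) (i : ℤ) :
    (⟨x, i⟩ : Repet k A) ⟶ ⟨x, i + 1⟩ :=
  dualHom i (idDual hA x)

/-- The composite lies in `D A(x, x)`, a line because `A(x, x) = k`. With its mirror image below,
this realises the evaluation pairing as composition. -/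
theorem levelHom_comp_dualHom_eq_smul {x y : A} (i : ℤ) (f : x ⟶ y)
    (β : Module.Dual k (x ⟶ y)) :
    levelHom i f ≫ dualHom i β = β f • socleHom hA x i := by
  rw [levelHom_comp_dualHom, socleHom, smul_dualHom]
  refine congrArg (dualHom i) ((dual_end_eq hA _).trans ?_)
  simp

theorem dualHom_comp_levelHom_eq_smul {x y : A} (i : ℤ) (β : Module.Dual k (y ⟶ x))
    (f : y ⟶ x) :
    dualHom i β ≫ levelHom (i + 1) f = β f • socleHom hA x i := by
  rw [dualHom_comp_levelHom, socleHom, smul_dualHom]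
  refine congrArg (dualHom i) ((dual_end_eq hA _).trans ?_)
  simp

theorem socleHom_ne_zero (x : A) (i : ℤ) : socleHom hA x i ≠ 0 := fun h => by
  have h1 : idDual hA x = 0 := congrArg (fun p => p.1.2) h
  have h2 := idDual_id hA x
  rw [h1] at h2
  exact zero_ne_one h2

/-- Both composites are scalars `c` and `d`. Computing `f g f` in two ways gives `c = d`, which is
nonzero, so `f` is invertible and its ends coincide. -/
theorem eq_of_comp_ne_zero [LocallyBounded k A] (hA : NoNonzeroOrientedCycles k A)
    {x y : A} (f : x ⟶ y) (g : y ⟶ x) (h : f ≫ g ≠ 0) : x = y := by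
  obtain ⟨c, hc⟩ := (hA x).2 (f ≫ g)
  obtain ⟨d, hd⟩ := (hA y).2 (g ≫ f)
  dsimp only at hc hd
  have hc0 : c ≠ 0 := by
    rintro rfl
    exact h (by rw [← hc, zero_smul])
  have hf0 : f ≠ 0 := by
    rintro rfl
    exact h Limits.zero_comp
  have hcd : c = d := by
    have : c • f = d • f := by
      rw [← Category.id_comp f, ← Linear.smul_comp, hc, Category.assoc, ← hd]
      simp
    exact smul_left_injective k hf0 this
  subst hcd
  refine LocallyBounded.eq_of_iso k x y ⟨⟨f, c⁻¹ • g, ?_, ?_⟩⟩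
  · rw [Linear.comp_smul, ← hc, inv_smul_smul₀ hc0]
  · rw [Linear.smul_comp, ← hd, inv_smul_smul₀ hc0]

end Acyclic

/-- Every nonzero morphism out of `X` stays nonzero after composition with some
morphism to `Z`. -/
def Detects {C : Type u} [Category.{v} C] [Preadditive C] (X Z : C) : Prop :=
  ∀ (Y : C) (f : X ⟶ Y), f ≠ 0 → ∃ g : Y ⟶ Z, f ≫ g ≠ 0

theorem Detects.map {C : Type u} [Category.{v} C] [Preadditive C] [Linear k C]
    (φ : LinIso k C C) {X Z : C} (h : Detects X Z) : Detects (φ.F.obj X) (φ.F.obj Z) := by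
  intro Y f hf
  obtain ⟨Y, rfl⟩ := φ.obj_bijective.2 Y
  obtain ⟨f, rfl⟩ := (φ.map_bijective _ _).2 f
  obtain ⟨g, hg⟩ := h Y f fun h0 => hf ((φ.map_eq_zero_iff f).2 h0)
  refine ⟨φ.F.map g, fun h0 => hg ?_⟩
  rw [← φ.map_eq_zero_iff, Functor.map_comp]
  exact h0

/-- The pairing is nondegenerate on both sides: a nonzero `f` is seen by some functional, a nonzero
functional by some morphism, and in either case the composite is a nonzero multiple of the socle
morphism. -/
theorem detects_shift (hA : NoNonzeroOrientedCycles k A) (x : A) (i : ℤ) :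
    Detects (⟨x, i⟩ : Repet k A) ⟨x, i + 1⟩ := by
  rintro ⟨y, j⟩ p hp
  by_cases h1 : j = i
  · subst h1
    obtain ⟨f, rfl⟩ := exists_levelHom_eq p
    have hf : f ≠ 0 := by
      rintro rfl
      exact hp rfl
    obtain ⟨β, hβ⟩ : ∃ β : Module.Dual k (x ⟶ y), β f ≠ 0 := by
      by_contra! h
      exact hf ((Module.forall_dual_apply_eq_zero_iff k f).1 h)
    refine ⟨dualHom j β, ?_⟩
    rw [levelHom_comp_dualHom_eq_smul hA]
    exact smul_ne_zero hβ (socleHom_ne_zero hA x j)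
  · by_cases h2 : j = i + 1
    · subst h2
      obtain ⟨β, rfl⟩ := exists_dualHom_eq p
      obtain ⟨a, ha⟩ : ∃ a, β a ≠ 0 := by
        by_contra! h
        exact hp (hom_ext rfl (LinearMap.ext h))
      refine ⟨levelHom (i + 1) a, ?_⟩
      rw [dualHom_comp_levelHom_eq_smul hA]
      exact smul_ne_zero ha (socleHom_ne_zero hA x i)
    · exact absurd (hom_eq_zero h1 h2 p) hp

/-- Testing on the socle morphism suffices: it dies under every morphism that raises the level, and
under every morphism of its level to another object, by `eq_of_comp_ne_zero`. -/
theorem eq_of_detects [LocallyBounded k A] (hA : NoNonzeroOrientedCycles k A) {x : A} {i : ℤ}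
    {Z : Repet k A} (h : Detects (⟨x, i⟩ : Repet k A) Z) : Z = ⟨x, i + 1⟩ := by
  obtain ⟨z, j⟩ := Z
  obtain ⟨g, hg⟩ := h _ _ (socleHom_ne_zero hA x i)
  by_cases hj : j = i + 1
  · subst hj
    obtain ⟨g, rfl⟩ := exists_levelHom_eq g
    obtain ⟨a, ha⟩ : ∃ a : z ⟶ x, idDual hA x (g ≫ a) ≠ 0 := by
      by_contra! h0
      refine hg ?_
      rw [socleHom, dualHom_comp_levelHom]
      exact hom_ext rfl (LinearMap.ext h0)
    rw [eq_of_comp_ne_zero hA g a]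
    intro h0
    exact ha (by rw [h0, map_zero])
  · refine absurd (hom_ext ?_ (LinearMap.ext fun a => ?_)) hg
    · exact Limits.zero_comp
    · rw [comp_snd, show g.1.1 = 0 from g.2.1 hj]
      change idDual hA x (0 ≫ a) + g.1.2 (a ≫ 0) = 0
      simp

theorem map_obj_shift [LocallyBounded k A] (hA : NoNonzeroOrientedCycles k A)
    (φ : LinIso k (Repet k A) (Repet k A)) (x : A) (i : ℤ) :
    φ.F.obj ⟨x, i + 1⟩ = ⟨(φ.F.obj ⟨x, i⟩).obj, (φ.F.obj ⟨x, i⟩).lvl + 1⟩ :=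
  eq_of_detects hA ((detects_shift hA x i).map φ)

/-- An automorphism of the repetitive category commutes with the Nakayama automorphism
on objects. -/
theorem map_obj_add [LocallyBounded k A] (hA : NoNonzeroOrientedCycles k A)
    (φ : LinIso k (Repet k A) (Repet k A)) (x : A) (i j : ℤ) :
    φ.F.obj ⟨x, i + j⟩ = ⟨(φ.F.obj ⟨x, i⟩).obj, (φ.F.obj ⟨x, i⟩).lvl + j⟩ := by
  induction j using Int.induction_on with
  | zero => simp
  | succ j ih => rw [← add_assoc, map_obj_shift hA, ih, add_assoc]
  | pred j ih =>
    have h := map_obj_shift hA φ x (i + (-(j : ℤ) - 1))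
    rw [add_assoc, sub_add_cancel, ih] at h
    refine Repet.ext (congrArg Repet.obj h).symm ?_
    have := congrArg Repet.lvl h
    dsimp only at this ⊢
    omega

/-- The hypothesis speaks of level zero only; commuting with the shift on objects spreads it to all
levels. -/
theorem HasJump.lvl_obj [LocallyBounded k A] (hA : NoNonzeroOrientedCycles k A)
    {φ : LinIso k (Repet k A) (Repet k A)} {n : ℤ} (hφ : HasJump φ n) (X : Repet k A) :
    (φ.F.obj X).lvl = X.lvl + n := by
  obtain ⟨x, i⟩ := X
  have h0 : (φ.F.obj ⟨x, 0⟩).lvl = n := hφ.subset ⟨⟨x, 0⟩, rfl, rfl⟩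
  have h := congrArg Repet.lvl (map_obj_add hA φ x 0 i)
  rw [zero_add] at h
  rw [h, h0, add_comm]

/-! ### The automorphism at level zero -/

variable (k A) in
/-- The functor from the repetitive category to `A` that forgets the levels and kills the
morphisms between distinct levels. -/
def proj : Repet k A ⥤ A where
  obj X := X.obj
  map p := p.1.1

/-- `proj` is a left inverse of `incl`, so the defining equation determines `φ₀`. -/
theorem IsLevelZero.F_eq {φ : LinIso k (Repet k A) (Repet k A)} {n : ℤ} {φ₀ : LinIso k A A}
    (h : IsLevelZero φ n φ₀) :
    φ₀.F = incl k A 0 ⋙ (φ.mul (nakayamaPow k A (-n))).F ⋙ proj k A :=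
  (congrArg (· ⋙ proj k A) (show _ = _ from h)).symm

theorem incl_proj_map_heq {X Y : Repet k A} {i : ℤ} (hX : X.lvl = i) (hY : Y.lvl = i)
    (p : X ⟶ Y) : HEq (levelHom (k := k) i p.1.1) p :=
  heq_of_val_eq hX.symm hY.symm (Prod.ext rfl (p.2.2 (by omega)).symm)

/-- An automorphism of the repetitive category that preserves the level zero induces an
automorphism of `A`. -/
theorem exists_levelZero (ψ : LinIso k (Repet k A) (Repet k A))
    (hψ : ∀ X, (ψ.F.obj X).lvl = 0 ↔ X.lvl = 0) :
    ∃ φ₀ : LinIso k A A, incl k A 0 ⋙ ψ.F = φ₀.F ⋙ incl k A 0 := by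
  have hl : ∀ x, (ψ.F.obj ⟨x, 0⟩).lvl = 0 := fun x => (hψ _).2 rfl
  refine ⟨⟨incl k A 0 ⋙ ψ.F ⋙ proj k A, ⟨fun {x y f g} => ?_⟩, ⟨fun {x y} f c => ?_⟩, ⟨?_, ?_⟩,
    fun x y => ⟨?_, ?_⟩⟩, ?_⟩
  · have : levelHom (k := k) 0 (f + g) = levelHom (k := k) 0 f + levelHom (k := k) 0 g :=
      hom_ext rfl (add_zero 0).symm
    change (ψ.F.map (levelHom 0 (f + g))).1.1 = _
    rw [this, Functor.map_add]
    rfl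
  · change (ψ.F.map (levelHom 0 (c • f))).1.1 = _
    rw [← smul_levelHom, Functor.map_smul]
    rfl
  · intro x y h
    have h' : ψ.F.obj ⟨x, 0⟩ = ψ.F.obj ⟨y, 0⟩ := Repet.ext h ((hl x).trans (hl y).symm)
    exact congrArg Repet.obj (ψ.obj_bijective.1 h')
  · intro y
    obtain ⟨⟨x, i⟩, hX⟩ := ψ.obj_bijective.2 ⟨y, 0⟩
    obtain rfl : i = 0 := (hψ ⟨x, i⟩).1 (congrArg Repet.lvl hX)
    exact ⟨x, congrArg Repet.obj hX⟩
  · intro f g h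
    refine levelHom_injective (k := k) 0 ((ψ.map_bijective _ _).1 (hom_ext h ?_))
    refine ((ψ.F.map _).2.2 ?_).trans ((ψ.F.map _).2.2 ?_).symm <;>
    · rw [hl, hl]
      decide
  · intro f
    let p : ψ.F.obj ⟨x, 0⟩ ⟶ ψ.F.obj ⟨y, 0⟩ := ⟨(f, 0), fun h => absurd ((hl y).trans (hl x).symm) h,
      fun _ => rfl⟩
    obtain ⟨q, hq⟩ := (ψ.map_bijective _ _).2 p
    obtain ⟨g, rfl⟩ := exists_levelHom_eq q
    exact ⟨g, congrArg (fun p => p.1.1) hq⟩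
  · refine Functor.hext (fun x => Repet.ext rfl (hl x)) fun x y f => ?_
    exact (incl_proj_map_heq (hl x) (hl y) _).symm

theorem IsLevelZero.unique {φ : LinIso k (Repet k A) (Repet k A)} {n : ℤ} {φ₀ φ₁ : LinIso k A A}
    (h₀ : IsLevelZero φ n φ₀) (h₁ : IsLevelZero φ n φ₁) : φ₀ = φ₁ :=
  LinIso.ext (h₀.F_eq.trans h₁.F_eq.symm)

theorem existsUnique_isLevelZero [LocallyBounded k A] (hA : NoNonzeroOrientedCycles k A)
    {φ : LinIso k (Repet k A) (Repet k A)} {n : ℤ} (hφ : HasJump φ n) :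
    ∃! φ₀ : LinIso k A A, IsLevelZero φ n φ₀ := by
  obtain ⟨φ₀, h⟩ := exists_levelZero (φ.mul (nakayamaPow k A (-n))) fun X => by
    change (φ.F.obj ⟨X.obj, X.lvl + -n⟩).lvl = 0 ↔ _
    rw [hφ.lvl_obj hA, neg_add_cancel_right]
  exact ⟨φ₀, h, fun φ₁ h₁ => IsLevelZero.unique h₁ h⟩

theorem IsLevelZero.obj_eq [LocallyBounded k A] (hA : NoNonzeroOrientedCycles k A)
    {φ : LinIso k (Repet k A) (Repet k A)} {n : ℤ} {φ₀ : LinIso k A A}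
    (h : IsLevelZero φ n φ₀) (X : Repet k A) : φ.F.obj X = (twist φ₀ n).F.obj X := by
  obtain ⟨x, i⟩ := X
  have h0 : φ.F.obj ⟨x, 0 + -n⟩ = ⟨φ₀.F.obj x, 0⟩ := Functor.congr_obj h x
  -- The definition of `φ₀` describes `φ` on level `-n`; shifting by `i + n` reaches level `i`.
  have h1 := map_obj_add hA φ x (0 + -n) (i + n)
  rw [h0, show 0 + -n + (i + n) = i by ring] at h1
  rw [h1]
  exact Repet.ext rfl (zero_add _)

/-! ### Automorphisms that fix the objects and one level -/

/-- A multiplicative family of linear automorphisms of the morphism spaces of the repetitive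
category that is the identity on one level is given by rescaling the objects. -/
theorem exists_scalars (hA : NoNonzeroOrientedCycles k A)
    (θ : ∀ X Y : Repet k A, (X ⟶ Y) ≃ₗ[k] (X ⟶ Y))
    (hθ : ∀ (X Y Z : Repet k A) (f : X ⟶ Y) (g : Y ⟶ Z), θ X Z (f ≫ g) = θ X Y f ≫ θ Y Z g)
    (i₀ : ℤ) (h₀ : ∀ (x y : A) (f : x ⟶ y),
      θ ⟨x, i₀⟩ ⟨y, i₀⟩ (levelHom i₀ f) = levelHom i₀ f) :
    ∃ μ : Repet k A → kˣ, ∀ (X Y : Repet k A) (f : X ⟶ Y),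
      θ X Y f = ((μ X)⁻¹ * μ Y) • f := by
  -- `θ` preserves the line `D A(x, x)`, so it scales its generator.
  have hc : ∀ X : Repet k A, ∃ c : kˣ, θ ⟨X.obj, X.lvl⟩ ⟨X.obj, X.lvl + 1⟩
      (socleHom hA X.obj X.lvl) = (c : k) • socleHom hA X.obj X.lvl := fun X => by
    obtain ⟨β, hβ⟩ := exists_dualHom_eq (θ ⟨X.obj, X.lvl⟩ ⟨X.obj, X.lvl + 1⟩
      (socleHom hA X.obj X.lvl))
    rw [dual_end_eq hA β, ← smul_dualHom] at hβ
    refine ⟨Units.mk0 (β (𝟙 _)) fun h => ?_, hβ⟩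
    rw [h, zero_smul] at hβ
    exact socleHom_ne_zero hA X.obj X.lvl ((LinearEquiv.map_eq_zero_iff _).1 hβ)
  choose c hc using hc
  -- The scaling of the socles forces `μ (x, i + 1) / μ (x, i) = c (x, i)`; normalising `μ = 1` on
  -- level `i₀` then fixes `μ` everywhere.
  obtain ⟨μ, hμ, hμ₀⟩ := (nakayamaPow k A 1).perm.exists_coboundary c (fun X => ⟨X.obj, i₀⟩)
    (fun X => X.lvl - i₀) (fun X => by
      have : ∀ j : ℤ, ((nakayamaPow k A 1).perm ^ j) ⟨X.obj, i₀⟩ = ⟨X.obj, i₀ + j⟩ := fun j => by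
        induction j using Int.induction_on with
        | zero => simp
        | succ j ih =>
          rw [add_comm, zpow_one_add, Equiv.Perm.mul_apply, ih]
          exact Repet.ext rfl (by change i₀ + j + 1 = _; ring)
        | pred j ih =>
          apply (nakayamaPow k A 1).perm.injective
          rw [← Equiv.Perm.mul_apply, ← zpow_one_add, add_sub_cancel, ih]
          exact Repet.ext rfl (by change _ = i₀ + (-(j : ℤ) - 1) + 1; ring)
      rw [this, add_sub_cancel]) (fun _ => rfl) (fun X => by
        change X.lvl + 1 - i₀ = 1 + (X.lvl - i₀)
        ring)
  replace hμ : ∀ x i, μ ⟨x, i + 1⟩ = c ⟨x, i⟩ * μ ⟨x, i⟩ := fun x i => hμ ⟨x, i⟩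
  -- The effect of `θ` on the pairing of `A(x, y)` with its dual, computed in two ways.
  have pair₁ : ∀ (x y : A) (i : ℤ) (f f' : x ⟶ y) (β β' : Module.Dual k (x ⟶ y)),
      θ ⟨x, i⟩ ⟨y, i⟩ (levelHom i f) = levelHom i f' →
      θ ⟨y, i⟩ ⟨x, i + 1⟩ (dualHom i β) = dualHom i β' → β' f' = c ⟨x, i⟩ * β f := by
    intro x y i f f' β β' hf hβ
    have h := hθ _ _ _ (levelHom i f) (dualHom i β)
    rw [hf, hβ, levelHom_comp_dualHom_eq_smul hA, levelHom_comp_dualHom_eq_smul hA, map_smul,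
      hc ⟨x, i⟩, smul_smul] at h
    rw [← smul_left_injective k (socleHom_ne_zero hA x i) h, mul_comm]
  have pair₂ : ∀ (x y : A) (i : ℤ) (f f' : x ⟶ y) (β β' : Module.Dual k (x ⟶ y)),
      θ ⟨x, i + 1⟩ ⟨y, i + 1⟩ (levelHom (i + 1) f) = levelHom (i + 1) f' →
      θ ⟨y, i⟩ ⟨x, i + 1⟩ (dualHom i β) = dualHom i β' → β' f' = c ⟨y, i⟩ * β f := by
    intro x y i f f' β β' hf hβ
    have h := hθ _ _ _ (dualHom i β) (levelHom (i + 1) f)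
    rw [hf, hβ, dualHom_comp_levelHom_eq_smul hA, dualHom_comp_levelHom_eq_smul hA, map_smul,
      hc ⟨y, i⟩, smul_smul] at h
    rw [← smul_left_injective k (socleHom_ne_zero hA y i) h, mul_comm]
  have hsep : ∀ {x y : A} {f g : x ⟶ y}, (∀ β : Module.Dual k (x ⟶ y), β f = β g) → f = g :=
    fun {x y f g} h => sub_eq_zero.1
      ((Module.forall_dual_apply_eq_zero_iff k _).1 fun β => by rw [map_sub, h, sub_self])
  -- Dividing the two computations of the pairing eliminates `β f`. Since `θ` is surjective, `β'` is
  -- arbitrary, and functionals separate morphisms.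
  have step : ∀ (x y : A) (i : ℤ) (f f₁ f₂ : x ⟶ y),
      θ ⟨x, i⟩ ⟨y, i⟩ (levelHom i f) = levelHom i f₁ →
      θ ⟨x, i + 1⟩ ⟨y, i + 1⟩ (levelHom (i + 1) f) = levelHom (i + 1) f₂ →
      (c ⟨y, i⟩ : k) • f₁ = (c ⟨x, i⟩ : k) • f₂ := by
    intro x y i f f₁ f₂ h1 h2
    refine hsep fun β' => ?_
    obtain ⟨p, hp⟩ := (θ ⟨y, i⟩ ⟨x, i + 1⟩).surjective (dualHom i β')
    obtain ⟨β, rfl⟩ := exists_dualHom_eq p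
    rw [map_smul, map_smul, pair₁ x y i f f₁ β β' h1 hp, pair₂ x y i f f₂ β β' h2 hp]
    simp only [smul_eq_mul]
    ring
  -- `step` can be solved for either level, so the induction runs up and down from `i₀`.
  have level : ∀ (i : ℤ) (x y : A) (f : x ⟶ y), θ ⟨x, i⟩ ⟨y, i⟩ (levelHom i f) =
      levelHom i ((((μ ⟨x, i⟩)⁻¹ * μ ⟨y, i⟩ : kˣ) : k) • f) := by
    intro i
    induction i using Int.inductionOn' (b := i₀) with
    | zero =>
      intro x y f
      rw [hμ₀ _ (sub_self i₀), hμ₀ _ (sub_self i₀), h₀]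
      simp
    | succ i _ ih =>
      intro x y f
      obtain ⟨f', hf'⟩ := exists_levelHom_eq (θ ⟨x, i + 1⟩ ⟨y, i + 1⟩ (levelHom (i + 1) f))
      have := step x y i f _ f' (ih x y f) hf'
      rw [hf', hμ, hμ]
      congr 1
      rw [← inv_smul_smul₀ (c ⟨x, i⟩).ne_zero f', ← this, smul_smul, smul_smul]
      congr 1
      push_cast
      field_simp
    | pred i _ ih =>
      intro x y f
      obtain ⟨j, rfl⟩ : ∃ j, i = j + 1 := ⟨i - 1, by ring⟩
      rw [add_sub_cancel_right]
      obtain ⟨f', hf'⟩ := exists_levelHom_eq (θ ⟨x, j⟩ ⟨y, j⟩ (levelHom j f))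
      have := step x y j f f' _ hf' (ih x y f)
      rw [hμ, hμ] at this
      rw [hf']
      congr 1
      rw [← inv_smul_smul₀ (c ⟨y, j⟩).ne_zero f', this, smul_smul, smul_smul]
      congr 1
      push_cast
      field_simp
  refine ⟨μ, ?_⟩
  rintro ⟨x, i⟩ ⟨y, j⟩ p
  by_cases h1 : j = i
  · subst h1
    obtain ⟨f, rfl⟩ := exists_levelHom_eq p
    rw [level, Units.smul_def, ← smul_levelHom]
  · by_cases h2 : j = i + 1
    · subst h2
      obtain ⟨β, rfl⟩ := exists_dualHom_eq p
      obtain ⟨β', hβ'⟩ := exists_dualHom_eq (θ ⟨x, i⟩ ⟨y, i + 1⟩ (dualHom i β))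
      rw [hβ', Units.smul_def, smul_dualHom]
      congr 1
      ext f
      -- On the dual part `θ` is contragredient to its effect on the level, up to the socle scalar.
      have := pair₁ y x i f _ β β' (level i y x f) hβ'
      rw [map_smul, smul_eq_mul] at this
      rw [hμ, LinearMap.smul_apply, smul_eq_mul]
      push_cast at this ⊢
      field_simp at this ⊢
      linear_combination this
    · rw [hom_eq_zero h1 h2 p, map_zero, smul_zero]

end Repet

/-! ### Comparing two automorphisms that agree on objects -/

section Comparison

variable {k : Type w} [Field k] {C : Type u} [Category.{v} C] [Preadditive C] [Linear k C]

/-- The family of automorphisms `ψ⁻¹ φ` of the morphism spaces, for automorphisms `φ` and `ψ` that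
agree on objects. -/
noncomputable def LinIso.compare (φ ψ : LinIso k C C) (h : ∀ x, φ.F.obj x = ψ.F.obj x) (x y : C) :
    (x ⟶ y) ≃ₗ[k] (x ⟶ y) :=
  φ.homEquiv x y ≪≫ₗ Linear.homCongr k (eqToIso (h x)) (eqToIso (h y)) ≪≫ₗ (ψ.homEquiv x y).symm

theorem LinIso.map_compare {φ ψ : LinIso k C C} (h : ∀ x, φ.F.obj x = ψ.F.obj x) {x y : C}
    (f : x ⟶ y) : ψ.F.map (φ.compare ψ h x y f) =
      eqToHom (h x).symm ≫ φ.F.map f ≫ eqToHom (h y) := by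
  refine ((ψ.homEquiv x y).apply_symm_apply _).trans ?_
  simp [Linear.homCongr_apply]

theorem LinIso.map_compare_heq {φ ψ : LinIso k C C} (h : ∀ x, φ.F.obj x = ψ.F.obj x) {x y : C}
    (f : x ⟶ y) : HEq (ψ.F.map (φ.compare ψ h x y f)) (φ.F.map f) := by
  rw [LinIso.map_compare]
  simp

theorem LinIso.compare_comp {φ ψ : LinIso k C C} (h : ∀ x, φ.F.obj x = ψ.F.obj x) (x y z : C)
    (f : x ⟶ y) (g : y ⟶ z) :
    φ.compare ψ h x z (f ≫ g) = φ.compare ψ h x y f ≫ φ.compare ψ h y z g := by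
  apply (ψ.map_bijective x z).1
  dsimp only
  simp [LinIso.map_compare]

theorem LinIso.exists_isRescaling {φ ψ : LinIso k C C} (h : ∀ x, φ.F.obj x = ψ.F.obj x)
    (hfree : ∀ (u : C) (j : ℤ), (φ.perm ^ j) u = u → j = 0) (μ : C → kˣ)
    (hμ : ∀ (x y : C) (f : x ⟶ y), φ.compare ψ h x y f = ((μ x)⁻¹ * μ y) • f) :
    ∃ m, φ.IsRescaling ψ m := by
  -- The hypothesis gives `φ f = (μ y / μ x) ψ f`. `IsRescaling` expresses `ψ` through `φ`, hence
  -- the inverse cocycle.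
  obtain ⟨m, hm⟩ := φ.perm.exists_coboundary_of_free hfree μ⁻¹
  refine ⟨m, h, fun {x y} f => ?_⟩
  have h1 := LinIso.map_compare_heq h f
  rw [hμ, Units.smul_def, Functor.map_smul] at h1
  convert heq_inv_smul (h x) (h y) h1.symm using 2
  rw [← LinIso.perm_apply, ← LinIso.perm_apply, hm, hm]
  apply Units.ext
  simp only [Pi.inv_apply]
  push_cast
  field_simp

end Comparison

/-! ### Free action and the main theorem -/

namespace Repet

variable {k : Type w} [Field k] {A : Type u} [Category.{v} A] [Preadditive A] [Linear k A]

/-- The power `φ^j` raises levels by `j * n`, and `n ≠ 0`. -/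
theorem perm_free {φ : LinIso k (Repet k A) (Repet k A)} {n : ℤ} (hn : n ≠ 0)
    (hφ : ∀ X, (φ.F.obj X).lvl = X.lvl + n) (X : Repet k A) (j : ℤ) (h : (φ.perm ^ j) X = X) :
    j = 0 := by
  have key : ∀ j : ℤ, ((φ.perm ^ j) X).lvl = X.lvl + j * n := fun j => by
    induction j using Int.induction_on with
    | zero => simp
    | succ j ih =>
      rw [add_comm, zpow_one_add, Equiv.Perm.mul_apply, LinIso.perm_apply, hφ, ih]
      ring
    | pred j ih =>
      have := hφ ((φ.perm ^ (-(j : ℤ) - 1)) X)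
      rw [← LinIso.perm_apply, ← Equiv.Perm.mul_apply, ← zpow_one_add, add_sub_cancel, ih] at this
      linear_combination -this
  have h1 := key j
  rw [h, left_eq_add] at h1
  exact (mul_eq_zero.1 h1).resolve_right hn

/-- An automorphism with nonzero jump is a rescaling of the twist by its level zero part. -/
theorem IsLevelZero.exists_isRescaling [LocallyBounded k A] (hA : NoNonzeroOrientedCycles k A)
    {φ : LinIso k (Repet k A) (Repet k A)} {n : ℤ} (hn : n ≠ 0) (hφ : HasJump φ n)
    {φ₀ : LinIso k A A} (h : IsLevelZero φ n φ₀) : ∃ m, φ.IsRescaling (twist φ₀ n) m := by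
  have hobj := h.obj_eq hA
  -- On level `-n` the two automorphisms coincide by the definition of `φ₀`. The form `0 + -n` is
  -- what `nakayamaPow` produces from level `0`.
  obtain ⟨μ, hμ⟩ := exists_scalars hA (φ.compare (twist φ₀ n) hobj) (LinIso.compare_comp hobj)
    (0 + -n) fun x y f => by
      apply ((twist φ₀ n).map_bijective _ _).1
      refine eq_of_heq ((LinIso.map_compare_heq hobj _).trans ?_)
      have h1 : HEq (φ.F.map (levelHom (k := k) (0 + -n) f)) ((incl k A 0).map (φ₀.F.map f)) :=
        Functor.hcongr_hom h f
      refine h1.trans (heq_of_val_eq (neg_add_cancel_right 0 n).symm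
        (neg_add_cancel_right 0 n).symm (Prod.ext rfl ?_))
      exact LinearMap.ext fun _ => rfl
  exact LinIso.exists_isRescaling hobj (perm_free hn (hφ.lvl_obj hA)) μ hμ

end Repet

/-- `A` is an algebra (a finite locally bounded category) without nonzero oriented cycles, and `φ`
an automorphism of its repetitive category with jump `n ≠ 0`. Then `φ₀` is a well-defined
automorphism of `A`, and the orbit categories of `φ` and of `φ̂₀ ν_A^n` are isomorphic as
`ℤ`-graded categories:
* for the classical orbit categories (objects are orbits), graded through base points `s` and `q`
  of the orbits; strictly degree preserving if the base points are the same on both sides, which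
  can always be arranged;
* for the orbit categories that have the same objects as the repetitive category. -/
theorem corollary4p3 {k : Type w} [Field k] {A : Type u} [Category.{v} A] [Preadditive A]
    [Linear k A] [Finite A] [LocallyBounded k A] (hA : NoNonzeroOrientedCycles k A)
    (φ : LinIso k (Repet k A) (Repet k A)) (n : ℤ) (hn : n ≠ 0) (hφ : Repet.HasJump φ n) :
    (∃! φ₀ : LinIso k A A, Repet.IsLevelZero φ n φ₀) ∧
    ∀ φ₀ : LinIso k A A, Repet.IsLevelZero φ n φ₀ →
      (∀ (s : Orbits φ → Repet k A) (q : Orbits (Repet.twist φ₀ n) → Repet k A),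
        (∀ X, orbitOf φ (s X) = X) → (∀ X, orbitOf (Repet.twist φ₀ n) (q X) = X) →
        GradedIsomorphic (orbitGrading φ s) (orbitGrading (Repet.twist φ₀ n) q)) ∧
      (∀ s : Orbits φ → Repet k A, (∀ X, orbitOf φ (s X) = X) →
        ∃ q : Orbits (Repet.twist φ₀ n) → Repet k A,
          (∀ X, orbitOf (Repet.twist φ₀ n) (q X) = X) ∧
          (∀ x, q (orbitOf (Repet.twist φ₀ n) x) = s (orbitOf φ x)) ∧
          StrictlyGradedIsomorphic (orbitGrading φ s) (orbitGrading (Repet.twist φ₀ n) q)) ∧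
      StrictlyGradedIsomorphic (orbitGrading φ (id : Repet k A → Repet k A))
        (orbitGrading (Repet.twist φ₀ n) (id : Repet k A → Repet k A)) := by
  refine ⟨Repet.existsUnique_isLevelZero hA hφ, fun φ₀ h => ?_⟩
  have hfree := Repet.perm_free hn (hφ.lvl_obj hA)
  have hfree' := Repet.perm_free (φ := Repet.twist φ₀ n) hn fun _ => rfl
  obtain ⟨m, hm⟩ := h.exists_isRescaling hA hn hφ
  -- Both automorphisms induce the same permutation of the objects, so the orbits are the same sets.
  let e : Orbits φ ≃ Orbits (Repet.twist φ₀ n) :=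
    Quotient.congr (Equiv.refl _) fun x y => by
      change φ.perm.SameCycle x y ↔ (Repet.twist φ₀ n).perm.SameCycle x y
      rw [hm.perm_eq]
  have he : ∀ x, e (orbitOf φ x) = orbitOf (Repet.twist φ₀ n) x := fun _ => rfl
  refine ⟨fun s q hs hq => ?_, fun s hs => ?_, ?_⟩
  · have hsame : ∀ X, φ.perm.SameCycle (s X) (q (e X)) := fun X => by
      have : orbitOf (Repet.twist φ₀ n) (s X) = orbitOf (Repet.twist φ₀ n) (q (e X)) := by
        rw [hq, ← he, hs]
      rw [hm.perm_eq]
      exact Quotient.exact this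
    choose d hd using hsame
    exact ⟨isGrading_orbitGrading hfree s, isGrading_orbitGrading hfree' q, _, _,
      hm.isDegreePreserving_orbitIso e d hd⟩
  · refine ⟨fun X => s (e.symm X), fun X => ?_, fun x => ?_, isGrading_orbitGrading hfree s,
      isGrading_orbitGrading hfree' _, _, hm.isDegreePreserving_orbitIso e (fun _ => 0) fun X => ?_⟩
    · rw [← he, hs, e.apply_symm_apply]
    · rw [← he]
      exact congrArg s (e.symm_apply_apply _)
    · rw [e.symm_apply_apply]
      rfl
  · exact ⟨isGrading_orbitGrading hfree _, isGrading_orbitGrading hfree' _, _,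
      hm.isDegreePreserving_orbitIso (Equiv.refl _) (fun _ => 0) fun _ => rfl⟩
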